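/- **Setting.** Let $n\ge 1$. A *basic integrator* consists of a differential equation $\dot x=f(x)$, with $f$ analytic on an open set $U\subset\mathbb C^d$, and a one-step map $\mathcal S_h$, analytic in $(h,x)$ near $\{0\}\times U$, with $\mathcal S_0=\mathrm{id}$, which is time-symmetric ($\mathcal S_h\circ\mathcal S_{-h}=\mathrm{id}$) and of order $2n$. It is *real* if $f$ and $\mathcal S$ commute with complex conjugation. A method $\phi_h$ has order $r$ at the points of $K$ if $\phi_h(x)=x(h)+\mathcal O(h^{r+1})$ as $h\to0$ ($h$ real) for every $x\in K$, where $x(\cdot)$ is the exact solution with $x(0)=x$. For $\alpha=(\alpha_1,\dots,\alpha_s)\in\mathbb C^s$ with $\overline{\alpha}_{s+1-l}=\alpha_l$ (symmetric-conjugate) and $\sum_l\alpha_l=1$ (consistent), put $\psi_h=\mathcal S_{\alpha_1h}\circ\cdots\circ\mathcal S_{\alpha_sh}$, and let $\overline\psi_h$ be the composition with coefficients $\overline\alpha_l$. Let $k\ge1$, let $\alpha^{(1)},\dots,\alpha^{(k)}$ be such coefficient vectors (of possibly different lengths), and $$\phi_h=\frac1{2k}\sum_{j=1}^k\bigl(\psi^{(j)}_h+\overline\psi{}^{(j)}_h\bigr).$$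 Let $Y_1,Y_{2n+1},Y_{2n+3},\dots$ be free non-commuting symbols, $Y(h)=hY_1+\sum_{i\ge0}h^{2n+1+2i}Y_{2n+1+2i}$, and $V(h)=\log\bigl(\exp Y(\alpha_sh)\cdots\exp Y(\alpha_1h)\bigr)$. Put $E_{m,1}=Y_m$ and $E_{m,l+1}=[Y_1,[Y_1,E_{m-2,l}]]$ for odd $m$. **Expansion.** There are real numbers $\mu_{m,l}$ such that the coefficients of $V(h)$ at $h^{2n+1}$ and $h^{2n+3}$ and, if $n\ge2$, at $h^{2n+5}$ are $$\mu_{2n+1,1}E_{2n+1,1},\qquad \sum_{l=1}^{2}\mu_{2n+3,l}E_{2n+3,l},\qquad \sum_{l=1}^{3}\mu_{2n+5,l}E_{2n+5,l}.$$ Let $\mu^{(j)}_{m,l}$ be any such numbers for $\alpha^{(j)}$, and $c_{m,l}=\sum_{j=1}^k\mu^{(j)}_{m,l}$. Consider the conditions * $C_{2n+2}$: $c_{2n+1,1}=0$; * $C_{2n+4}$: $c_{2n+1,1}=c_{2n+3,1}=c_{2n+3,2}=0$; * $C_{2n+6}$: $c_{2n+1,1}=c_{2n+3,1}=c_{2n+3,2}=c_{2n+5,1}=c_{2n+5,2}=c_{2n+5,3}=0$.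 **Order conditions.** Let $r=2n+2q$ with $q\in\{1,2,3\}$, and $n\ge2$ if $q=3$ (so that $r\le4n+3$). If $r\le4n+1$, or if $\mu^{(j)}_{2n+1,1}$ does not depend on $j$, then "$\phi_h$ has order $r$" is equivalent to $C_r$, in each of the following senses: 1. for every single basic integrator and every $K\subset U$ for which the brackets $E_{m,1},\dots,E_{m,(m-2n+1)/2}$, as vector fields restricted to $K$, are linearly independent over $\mathbb R$ for each $m=2n+1,2n+3,\dots,2n+2q-1$ (here $Y_m$ is the operator defined by $g(\mathcal S_h(x))=\exp(\sum_m h^mY_m)[g](x)$ for all analytic $g$): $\phi_h$ has order $r$ at the points of $K$ if and only if $C_r$ holds; 2. $\phi_h$ has order $r$ on $U$ for all basic integrators (in all dimensions $d$) if and only if $C_r$ holds; 3. $\phi_h$ has order $r$ at the real points of $U$ for all real basic integrators (in all dimensions $d$) if and only if $C_r$ holds. In particular this always applies to $r=2n+2$; it applies to $r=2n+4$ if $n\ge2$ and to $r=2n+6$ if $n\ge3$. For all the $r$ considered, $C_r$ is necessary in the senses 1–3 even if $r>4n+1$ and $\mu^{(j)}_{2n+1,1}$ depends on $j$. -/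

import Mathlib

open Filter Topology

noncomputable section

namespace SymConj

/-! ### Exponential and logarithm of formal power series in the step size -/

section Series

variable {R : Type*} [Ring R] [Algebra ℂ R]

/-- `exp X = ∑_q X^q / q!`, for a power series `X` without constant term
(so that only `q ≤ N` contributes to the coefficient of `h^N`). -/
def expSeries (X : PowerSeries R) : PowerSeries R :=
  PowerSeries.mk fun N =>
    ∑ q ∈ Finset.range (N + 1), ((q.factorial : ℂ)⁻¹) • PowerSeries.coeff N (X ^ q)

/-- `log Z = ∑_{q ≥ 1} (-1)^(q+1) (Z - 1)^q / q`, for a power series `Z` with constant term `1`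
(so that only `q ≤ N` contributes to the coefficient of `h^N`). -/
def logSeries (Z : PowerSeries R) : PowerSeries R :=
  PowerSeries.mk fun N =>
    ∑ q ∈ Finset.Icc 1 N, ((-1 : ℂ) ^ (q + 1) / (q : ℂ)) • PowerSeries.coeff N ((Z - 1) ^ q)

/-- The series `X(a h)` obtained from `X(h)`. -/
def dilate (a : ℂ) (X : PowerSeries R) : PowerSeries R :=
  PowerSeries.mk fun m => a ^ m • PowerSeries.coeff m X

end Series

/-! ### The formal series of a composition -/

/-- The free associative algebra on symbols `Y_0, Y_1, Y_2, …`; its commutator brackets of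
the symbols are the elements of the free Lie algebra. -/
abbrev Words : Type := FreeAlgebra ℂ ℕ

/-- The symbol `Y_m`. -/
def Y (m : ℕ) : Words := FreeAlgebra.ι ℂ m

/-- `Y(h) = h Y_1 + h^(2n+1) Y_(2n+1) + h^(2n+3) Y_(2n+3) + ⋯`. -/
def basicSeries (n : ℕ) : PowerSeries Words :=
  PowerSeries.mk fun m => open Classical in
    if m = 1 ∨ (2 * n + 1 ≤ m ∧ Odd m) then Y m else 0

/-- `Ψ(h) = exp(Y(h α_s)) ⋯ exp(Y(h α_2)) exp(Y(h α_1))` for `α = [α_1, …, α_s]`. -/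
def compSeries (n : ℕ) (α : List ℂ) : PowerSeries Words :=
  (α.reverse.map fun a => expSeries (dilate a (basicSeries n))).prod

/-- `V(h) = log Ψ(h)`. -/
def logCompSeries (n : ℕ) (α : List ℂ) : PowerSeries Words :=
  logSeries (compSeries n α)

/-- The bracket basis in odd degree: `E_(m,1) = Y_m` and `E_(m,l+1) = [Y_1, [Y_1, E_(m-2,l)]]`,
that is, `E_(m,l)` is obtained from `Y_(m-2(l-1))` by bracketing `2(l-1)` times with `Y_1`. -/
def E (m l : ℕ) : Words :=
  (fun X : Words => ⁅Y 1, ⁅Y 1, X⁆⁆)^[l - 1] (Y (m - 2 * (l - 1)))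

/-- The real numbers `μ m l` are the coefficients of the brackets `E_(m,l)` in
`V(h) = log Ψ(h)`, in the degrees `m = 2n+1`, `m = 2n+3` and (for `n ≥ 2`) `m = 2n+5`. -/
structure IsBracketExpansion (n : ℕ) (α : List ℂ) (μ : ℕ → ℕ → ℝ) : Prop where
  deg_one : PowerSeries.coeff (2 * n + 1) (logCompSeries n α) =
    (μ (2 * n + 1) 1 : ℂ) • E (2 * n + 1) 1
  deg_three : PowerSeries.coeff (2 * n + 3) (logCompSeries n α) =
    (μ (2 * n + 3) 1 : ℂ) • E (2 * n + 3) 1 + (μ (2 * n + 3) 2 : ℂ) • E (2 * n + 3) 2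
  deg_five : 2 ≤ n → PowerSeries.coeff (2 * n + 5) (logCompSeries n α) =
    (μ (2 * n + 5) 1 : ℂ) • E (2 * n + 5) 1 + (μ (2 * n + 5) 2 : ℂ) • E (2 * n + 5) 2
      + (μ (2 * n + 5) 3 : ℂ) • E (2 * n + 5) 3

/-! ### Differential equations, integrators, compositions -/

/-- The one-step method `φ` has order `r` at the points of `K` for `x' = f(x)`: for every `x ∈ K`,
`φ_h(x) = x(h) + O(h^(r+1))` as `h → 0`, where `x(h)` is the exact solution with `x(0) = x`. -/
def HasOrder {d : ℕ} (f : (Fin d → ℂ) → (Fin d → ℂ)) (K : Set (Fin d → ℂ))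
    (φ : ℝ → (Fin d → ℂ) → (Fin d → ℂ)) (r : ℕ) : Prop :=
  ∀ x ∈ K, ∀ y : ℝ → (Fin d → ℂ), y 0 = x →
    (∀ᶠ t in 𝓝 (0 : ℝ), HasDerivAt y (f (y t)) t) →
    (fun h : ℝ => φ h x - y h) =O[𝓝 0] fun h : ℝ => h ^ (r + 1)

/-- A differential equation `x' = f(x)` with `f` analytic on an open set `U`, together with a
time-symmetric integrator `S_h` of order `2n` for it, analytic in the (complex) step size and in
the state. -/
structure BasicIntegrator (n d : ℕ) where
  U : Set (Fin d → ℂ)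
  isOpen_U : IsOpen U
  f : (Fin d → ℂ) → (Fin d → ℂ)
  analytic_f : AnalyticOnNhd ℂ f U
  S : ℂ → (Fin d → ℂ) → (Fin d → ℂ)
  analytic_S : ∀ x ∈ U, AnalyticAt ℂ (fun p : ℂ × (Fin d → ℂ) => S p.1 p.2) (0, x)
  S_zero : ∀ x ∈ U, S 0 x = x
  symmetric : ∀ x ∈ U, ∀ᶠ h in 𝓝 (0 : ℂ), S h (S (-h) x) = x
  order : HasOrder f U (fun h => S (h : ℂ)) (2 * n)

/-- The vectors with real coordinates. -/
def realPoints (d : ℕ) : Set (Fin d → ℂ) := {x | star x = x}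

/-- The vector field and the integrator are real, i.e. commute with complex conjugation. -/
structure BasicIntegrator.IsReal {n d : ℕ} (B : BasicIntegrator n d) : Prop where
  star_mem : ∀ x ∈ B.U, star x ∈ B.U
  star_f : ∀ x ∈ B.U, B.f (star x) = star (B.f x)
  star_S : ∀ x ∈ B.U, ∀ᶠ h in 𝓝 (0 : ℂ), B.S (star h) (star x) = star (B.S h x)

/-- `S_(α_1 h) ∘ S_(α_2 h) ∘ ⋯ ∘ S_(α_s h)` for `α = [α_1, …, α_s]`. -/
def composition {d : ℕ} (S : ℂ → (Fin d → ℂ) → (Fin d → ℂ)) :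
    List ℂ → ℂ → (Fin d → ℂ) → (Fin d → ℂ)
  | [], _ => id
  | a :: α, h => S (a * h) ∘ composition S α h

/-- The composition with coefficients `α_1, …, α_s` is symmetric-conjugate
(`conj α_(s+1-j) = α_j`) and consistent (`∑ α_j = 1`). -/
def IsConsistentSymConj (α : List ℂ) : Prop :=
  α.reverse.map star = α ∧ α.sum = 1

/-- `φ_h = (1/(2k)) ∑_j (ψ_h^(j) + conj ψ_h^(j))`, where `ψ^(j)` is the composition with
coefficients `α j` and `conj ψ^(j)` the one with the complex conjugate coefficients. -/
def linComb {d k : ℕ} (S : ℂ → (Fin d → ℂ) → (Fin d → ℂ)) (α : Fin k → List ℂ)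
    (h : ℝ) (x : Fin d → ℂ) : Fin d → ℂ :=
  ((1 : ℂ) / (2 * k)) •
    ∑ j, (composition S (α j) h x + composition S ((α j).map star) h x)

/-! ### The operators associated with an integrator -/

theorem analyticAt_iteratedDeriv_fst {d : ℕ} {F : ℂ × (Fin d → ℂ) → ℂ}
    {p₀ : ℂ × (Fin d → ℂ)} (hF : AnalyticAt ℂ F p₀) (m : ℕ) :
    AnalyticAt ℂ (fun p : ℂ × (Fin d → ℂ) => iteratedDeriv m (fun h => F (h, p.2)) p.1) p₀ := by
  induction m with
  | zero => simpa using hF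
  | succ m ih =>
    set G : ℂ × (Fin d → ℂ) → ℂ := fun p => iteratedDeriv m (fun h => F (h, p.2)) p.1 with hG
    have h1 : AnalyticAt ℂ (fun p => fderiv ℂ G p ((1 : ℂ), (0 : Fin d → ℂ))) p₀ :=
      (ContinuousLinearMap.apply ℂ ℂ ((1 : ℂ), (0 : Fin d → ℂ))).analyticAt _ |>.comp ih.fderiv
    refine h1.congr ?_
    filter_upwards [ih.eventually_analyticAt] with p hp
    rw [iteratedDeriv_succ]
    have h2 : HasDerivAt (fun h : ℂ => (h, p.2)) ((1 : ℂ), (0 : Fin d → ℂ)) p.1 :=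
      (hasDerivAt_id p.1).prodMk (hasDerivAt_const p.1 p.2)
    have h3 : HasFDerivAt G (fderiv ℂ G p) (p.1, p.2) := hp.differentiableAt.hasFDerivAt
    exact (h3.comp_hasDerivAt p.1 h2).deriv.symm

namespace BasicIntegrator

variable {n d : ℕ} (B : BasicIntegrator n d)

/-- The analytic functions on `U` (extended by zero outside of `U`). -/
def functions : Submodule ℂ ((Fin d → ℂ) → ℂ) where
  carrier := {g | AnalyticOnNhd ℂ g B.U ∧ ∀ x ∉ B.U, g x = 0}
  add_mem' := fun ha hb => ⟨ha.1.add hb.1, fun x hx => by simp [ha.2 x hx, hb.2 x hx]⟩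
  zero_mem' := ⟨analyticOnNhd_const, fun _ _ => rfl⟩
  smul_mem' := fun c g hg =>
    ⟨fun x hx => analyticAt_const.mul (hg.1 x hx), fun x hx => by simp [hg.2 x hx]⟩

/-- The coordinate function `x_i` on `U`. -/
def coord (i : Fin d) : B.functions :=
  ⟨B.U.indicator fun x => x i, fun x hx => by
    have h1 : AnalyticAt ℂ (fun x : Fin d → ℂ => x i) x :=
      (ContinuousLinearMap.proj (R := ℂ) (φ := fun _ : Fin d => ℂ) i).analyticAt x
    refine h1.congr ?_
    filter_upwards [B.isOpen_U.mem_nhds hx] with z hz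
    rw [Set.indicator_of_mem hz], fun x hx => Set.indicator_of_notMem hx _⟩

theorem analyticAt_comp_S (g : B.functions) {x : Fin d → ℂ} (hx : x ∈ B.U) :
    AnalyticAt ℂ (fun p : ℂ × (Fin d → ℂ) => g.1 (B.S p.1 p.2)) (0, x) := by
  exact (g.2.1 x hx).comp_of_eq (B.analytic_S x hx) (B.S_zero x hx)

/-- The operator `g ↦ (1/m!) (d/dh)^m g(S_h(x))` at `h = 0`, so that
`g(S_h(x)) = ∑_m h^m (B.taylor m g)(x)`. -/
def taylor (m : ℕ) : Module.End ℂ B.functions where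
  toFun g := ⟨B.U.indicator fun x =>
      ((m.factorial : ℂ)⁻¹) * iteratedDeriv m (fun h => g.1 (B.S h x)) 0, fun x hx => by
    have h1 := analyticAt_iteratedDeriv_fst (B.analyticAt_comp_S g hx) m
    have h2 : AnalyticAt ℂ (fun z : Fin d → ℂ => ((0 : ℂ), z)) x :=
      analyticAt_const.prod analyticAt_id
    have h3 : AnalyticAt ℂ
        (fun z => ((m.factorial : ℂ)⁻¹) * iteratedDeriv m (fun h => g.1 (B.S h z)) 0) x :=
      analyticAt_const.mul (AnalyticAt.comp (x := x) h1 h2)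
    refine h3.congr ?_
    filter_upwards [B.isOpen_U.mem_nhds hx] with z hz
    rw [Set.indicator_of_mem hz], fun x hx => Set.indicator_of_notMem hx _⟩
  map_add' g₁ g₂ := by
    ext x
    by_cases hx : x ∈ B.U
    · have hc : ∀ g : B.functions, ContDiffAt ℂ m (fun h => g.1 (B.S h x)) 0 := fun g => by
        have h2 : AnalyticAt ℂ (fun h : ℂ => (h, x)) 0 := analyticAt_id.prod analyticAt_const
        have h3 : AnalyticAt ℂ (fun h : ℂ => g.1 (B.S h x)) 0 :=
          (B.analyticAt_comp_S g hx).comp_of_eq h2 rfl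
        exact h3.contDiffAt
      have h4 := iteratedDeriv_fun_add (hc g₁) (hc g₂)
      simp [hx, h4, mul_add]
    · simp [hx]
  map_smul' c g := by
    ext x
    by_cases hx : x ∈ B.U
    · simp [hx, mul_left_comm]
    · simp [hx]

/-- The series of operators `Y(h) = ∑_m h^m Y_m` with `g(S_h(x)) = exp(Y(h))[g](x)`. -/
def operatorSeries : PowerSeries (Module.End ℂ B.functions) :=
  logSeries (PowerSeries.mk B.taylor)

/-- Replaces every symbol `Y_m` by the corresponding operator of the integrator. -/
def toOperator : Words →ₐ[ℂ] Module.End ℂ B.functions :=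
  FreeAlgebra.lift ℂ fun m => PowerSeries.coeff m B.operatorSeries

/-- The coordinates at the points of `K` of the vector field given by the operator of `X`. -/
def components (K : Set (Fin d → ℂ)) (X : Words) : Fin d → K → ℂ :=
  fun i x => (B.toOperator X (B.coord i)).1 x

/-- For each of the degrees `2n+1, 2n+3, …, 2n+2q-1`, the brackets `E_(2n+2p-1,1), …,
E_(2n+2p-1,p)` of the operators of this integrator are linearly independent on `K`. -/
def Independent (q : ℕ) (K : Set (Fin d → ℂ)) : Prop :=
  ∀ p, 1 ≤ p → p ≤ q → LinearIndependent ℝ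
    (fun l : Fin p => B.components K (E (2 * n + 2 * p - 1) (l + 1)))

end BasicIntegrator

/-! ### Conditions characterising the order -/

/-- `C` is equivalent to `φ_h` having order `r`: for each single integrator whose brackets in
degrees up to `2n+2q-1` are independent, for all integrators at once, and for all real integrators
at once. -/
def OrderIff (n : ℕ) {k : ℕ} (α : Fin k → List ℂ) (q r : ℕ) (C : Prop) : Prop :=
  (∀ (d : ℕ) (B : BasicIntegrator n d) (K : Set (Fin d → ℂ)), K ⊆ B.U → B.Independent q K →
      (HasOrder B.f K (linComb B.S α) r ↔ C)) ∧
  ((∀ (d : ℕ) (B : BasicIntegrator n d), HasOrder B.f B.U (linComb B.S α) r) ↔ C) ∧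
  ((∀ (d : ℕ) (B : BasicIntegrator n d), B.IsReal →
      HasOrder B.f (B.U ∩ realPoints d) (linComb B.S α) r) ↔ C)

/-- `C` is necessary for `φ_h` to have order `r`, in the same three senses. -/
def OrderImplies (n : ℕ) {k : ℕ} (α : Fin k → List ℂ) (q r : ℕ) (C : Prop) : Prop :=
  (∀ (d : ℕ) (B : BasicIntegrator n d) (K : Set (Fin d → ℂ)), K ⊆ B.U → B.Independent q K →
      (HasOrder B.f K (linComb B.S α) r → C)) ∧
  ((∀ (d : ℕ) (B : BasicIntegrator n d), HasOrder B.f B.U (linComb B.S α) r) → C) ∧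
  ((∀ (d : ℕ) (B : BasicIntegrator n d), B.IsReal →
      HasOrder B.f (B.U ∩ realPoints d) (linComb B.S α) r) → C)

/-- The range of orders in which the order of `φ_h` is governed by the sums `c_(m,l)` alone:
`r ≤ 4n+1`, or `r ≤ 4n+3` if all the compositions have the same `μ_(2n+1,1)`. -/
def InRange (n : ℕ) {k : ℕ} (μ : Fin k → ℕ → ℕ → ℝ) (r : ℕ) : Prop :=
  r ≤ 4 * n + 1 ∨ (r ≤ 4 * n + 3 ∧ ∀ i j, μ i (2 * n + 1) 1 = μ j (2 * n + 1) 1)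

/-- `c_(m,l) = ∑_j μ^(j)_(m,l)`. -/
def c {k : ℕ} (μ : Fin k → ℕ → ℕ → ℝ) (m l : ℕ) : ℝ := ∑ j, μ j m l

end SymConj

end

open Filter Topology

noncomputable section

namespace SymConj

/-! ### Power series vanishing to a given order -/

section Truncation

variable {R : Type*} [Ring R] [Algebra ℂ R]

/-! Composing a function `g` with a map turns the map into a linear operator. The integrator becomes
`exp Y(h)`. Its order `2n` forces `Y(h) = h Y_1 + O(h^(2n+1))`, and time symmetry makes `Y` odd
(`map_toOperator_basicSeries`). Compositions become products of such exponentials in reversed order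
(`represents_composition`), so the error of the averaged method is the image of one formal series in
the free algebra, `defect`. Having order `r` means exactly that its coefficients up to degree `r`
vanish on the coordinate functions (`hasOrder_linComb_iff`).

In the free algebra, a product of two symbols of index at least `2n+1` has degree at least `4n+2`.
Below that degree `V(h) - h Y_1` is therefore linear in the higher symbols, that is, a combination
of iterated brackets with `Y_1` (`coeff_logCompSeries_sub_mem`). In odd degree the number of
brackets is even, which leaves precisely the `E m l`. Reversing a coefficient list and replacing `h`
by `-h` inverts the product. For symmetric-conjugate lists reversal is conjugation, so the conjugate
of `V` is `-V(-h)` (`coeff_logCompSeries_star`): odd coefficients are real, and even ones cancel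
between a composition and its conjugate.

Let `δ_i` be the deviations of all logarithms from `h Y_1`, all `O(h^s)`. The sum of `exp(h Y_1 +
δ_i) - exp(h Y_1)` depends on the `δ_i` through their sum, up to terms `O(h^(2s))`. Hence vanishing
of the sum below degree `N ≤ 2s` suffices (`defect_mem_of_sum_mem`), and the first surviving
coefficient of the defect in degree at most `4n+1` is that of the sum (`coeff_defect_eq`). In
general `s = 2n+1`. If all `μ_(2n+1,1)` agree and their sum is zero, each vanishes and `s = 2n+2`.
Necessity uses only the odd degrees `2n+1`, `2n+3`, `2n+5`, all at most `4n+1`, so it needs no bound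
on `r`.

Independence of the brackets turns vanishing vector fields into vanishing coefficients. For the two
statements about all integrators one real test integrator with independent brackets is enough:
`affineIntegrator`, where bracketing twice with `Y_1` is the identity on constant fields. -/

@[simp] theorem coeff_complex_smul (c : ℂ) (F : PowerSeries R) (i : ℕ) :
    PowerSeries.coeff i (c • F) = c • PowerSeries.coeff i F := rfl

variable (R) in
/-- The power series whose coefficients below degree `m` vanish. -/
def orderGE (m : ℕ) : Submodule ℂ (PowerSeries R) where
  carrier := {F | ∀ i < m, PowerSeries.coeff i F = 0}
  add_mem' ha hb i hi := by simp [ha i hi, hb i hi]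
  zero_mem' i _ := by simp
  smul_mem' c F hF i hi := by simp [hF i hi]

theorem orderGE_mono {m m' : ℕ} (h : m' ≤ m) : orderGE R m ≤ orderGE R m' :=
  fun _ hF i hi => hF i (hi.trans_le h)

theorem mem_orderGE_zero (F : PowerSeries R) : F ∈ orderGE R 0 := fun _ h => absurd h (by simp)

theorem mem_orderGE_one {F : PowerSeries R} :
    F ∈ orderGE R 1 ↔ PowerSeries.coeff 0 F = 0 :=
  ⟨fun h => h 0 one_pos, fun h i hi => by obtain rfl : i = 0 := by omega
                                          exact h⟩

theorem mul_mem_orderGE {a b m : ℕ} (h : m ≤ a + b) {F G : PowerSeries R}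
    (hF : F ∈ orderGE R a) (hG : G ∈ orderGE R b) : F * G ∈ orderGE R m := by
  intro i hi
  rw [PowerSeries.coeff_mul]
  refine Finset.sum_eq_zero fun p hp => ?_
  rw [Finset.HasAntidiagonal.mem_antidiagonal] at hp
  by_cases h1 : p.1 < a
  · rw [hF _ h1, zero_mul]
  · rw [hG _ (by omega), mul_zero]

theorem mul_mem_orderGE_left {m : ℕ} (F : PowerSeries R) {G : PowerSeries R}
    (hG : G ∈ orderGE R m) : F * G ∈ orderGE R m :=
  mul_mem_orderGE (by omega) (mem_orderGE_zero F) hG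

theorem mul_mem_orderGE_right {m : ℕ} {F : PowerSeries R} (G : PowerSeries R)
    (hF : F ∈ orderGE R m) : F * G ∈ orderGE R m :=
  mul_mem_orderGE (by omega) hF (mem_orderGE_zero G)

theorem pow_mem_orderGE {F : PowerSeries R} (hF : F ∈ orderGE R 1) (q : ℕ) :
    F ^ q ∈ orderGE R q := by
  induction q with
  | zero => exact mem_orderGE_zero _
  | succ q ih => rw [pow_succ]; exact mul_mem_orderGE le_rfl ih hF

theorem eq_of_sub_mem_orderGE {F G : PowerSeries R} (h : ∀ m, F - G ∈ orderGE R m) : F = G := by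
  ext i
  have := h (i + 1) i (by omega)
  rwa [map_sub, sub_eq_zero] at this

theorem mul_sub_mul_mem_orderGE {m : ℕ} {F F' G G' : PowerSeries R} (hF : F - F' ∈ orderGE R m)
    (hG : G - G' ∈ orderGE R m) : F * G - F' * G' ∈ orderGE R m := by
  have : F * G - F' * G' = (F - F') * G + F' * (G - G') := by noncomm_ring
  rw [this]
  exact add_mem (mul_mem_orderGE_right _ hF) (mul_mem_orderGE_left _ hG)

theorem sub_mem_orderGE_trans {m : ℕ} {F G H : PowerSeries R} (h₁ : F - G ∈ orderGE R m)
    (h₂ : G - H ∈ orderGE R m) : F - H ∈ orderGE R m := by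
  simpa using add_mem h₁ h₂

theorem coeff_mul_of_mem_orderGE {m : ℕ} {F G : PowerSeries R} (hG : G ∈ orderGE R m) :
    PowerSeries.coeff m (F * G) = PowerSeries.coeff 0 F * PowerSeries.coeff m G := by
  rw [PowerSeries.coeff_mul, Finset.sum_eq_single (0, m)]
  · rintro ⟨a, b⟩ hp hne
    rw [Finset.HasAntidiagonal.mem_antidiagonal] at hp
    have : b < m := by
      rcases Nat.lt_or_ge b m with h | h
      · exact h
      · exact absurd (by simp at hp ⊢; omega) hne
    simp only [hG b this, mul_zero]
  · simp

end Truncation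

/-! ### Substitution of a series into a scalar power series -/

section Substitution

variable {R : Type*} [Ring R] [Algebra ℂ R]

/-- `∑_q p_q X^q`, for a power series `X` without constant term. -/
def evalSeries (X : PowerSeries R) (p : PowerSeries ℂ) : PowerSeries R :=
  PowerSeries.mk fun N =>
    ∑ q ∈ Finset.range (N + 1), PowerSeries.coeff q p • PowerSeries.coeff N (X ^ q)

theorem aeval_mem_orderGE {X : PowerSeries R} (hX : X ∈ orderGE R 1) {M : ℕ} {p : Polynomial ℂ}
    (hp : ∀ q < M, p.coeff q = 0) : Polynomial.aeval X p ∈ orderGE R M := by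
  rw [Polynomial.aeval_eq_sum_range]
  refine Submodule.sum_mem _ fun q _ => ?_
  rcases Nat.lt_or_ge q M with h | h
  · rw [hp q h, zero_smul]; exact zero_mem _
  · exact Submodule.smul_mem _ _ (orderGE_mono h (pow_mem_orderGE hX q))

/-- Since `X ^ q` has order at least `q`, only finitely many terms matter below degree `M`.
Identities for substituted series thereby reduce to identities for polynomials. -/
theorem evalSeries_sub_aeval_mem {X : PowerSeries R} (hX : X ∈ orderGE R 1) (M : ℕ)
    (p : PowerSeries ℂ) :
    evalSeries X p - Polynomial.aeval X (PowerSeries.trunc M p) ∈ orderGE R M := by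
  intro N hN
  rw [map_sub, sub_eq_zero, evalSeries, PowerSeries.coeff_mk, PowerSeries.trunc_apply,
    ← Finset.range_eq_Ico, map_sum, map_sum]
  have h : ∀ q, PowerSeries.coeff N (Polynomial.aeval X
      (Polynomial.monomial q (PowerSeries.coeff q p))) =
      PowerSeries.coeff q p • PowerSeries.coeff N (X ^ q) := fun q => by
    rw [Polynomial.aeval_monomial, ← Algebra.smul_def, coeff_complex_smul]
  simp only [h]
  refine Finset.sum_subset (fun q hq => ?_) fun q hq hq' => ?_
  · simp at hq ⊢; omega
  · rw [pow_mem_orderGE hX q N (by simp at hq'; omega), smul_zero]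

theorem evalSeries_mem_orderGE {X : PowerSeries R} (hX : X ∈ orderGE R 1) {M : ℕ}
    {p : PowerSeries ℂ} (hp : p ∈ orderGE ℂ M) : evalSeries X p ∈ orderGE R M := by
  have h := evalSeries_sub_aeval_mem hX M p
  have h0 : PowerSeries.trunc M p = 0 := by
    ext q
    rw [PowerSeries.coeff_trunc]
    split_ifs with hq
    · simpa using hp q hq
    · simp
  simpa [h0] using h

theorem evalSeries_mul {X : PowerSeries R} (hX : X ∈ orderGE R 1) (p q : PowerSeries ℂ) :
    evalSeries X (p * q) = evalSeries X p * evalSeries X q := by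
  refine eq_of_sub_mem_orderGE fun M => ?_
  refine sub_mem_orderGE_trans (evalSeries_sub_aeval_mem hX M (p * q)) ?_
  have h := mul_sub_mul_mem_orderGE (evalSeries_sub_aeval_mem hX M p)
    (evalSeries_sub_aeval_mem hX M q)
  refine sub_mem_orderGE_trans ?_ (by rw [← neg_sub]; exact neg_mem h)
  rw [← map_mul, ← map_sub]
  refine aeval_mem_orderGE hX fun i hi => ?_
  rw [Polynomial.coeff_sub, PowerSeries.coeff_trunc, if_pos hi, ← Polynomial.coeff_coe,
    Polynomial.coe_mul, PowerSeries.coeff_mul, PowerSeries.coeff_mul, sub_eq_zero]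
  refine Finset.sum_congr rfl fun x hx => ?_
  rw [Finset.HasAntidiagonal.mem_antidiagonal] at hx
  rw [Polynomial.coeff_coe, Polynomial.coeff_coe, PowerSeries.coeff_trunc, PowerSeries.coeff_trunc,
    if_pos (by omega), if_pos (by omega)]

theorem evalSeries_add (X : PowerSeries R) (p q : PowerSeries ℂ) :
    evalSeries X (p + q) = evalSeries X p + evalSeries X q := by
  ext N
  simp [evalSeries, add_smul, Finset.sum_add_distrib]

theorem evalSeries_C (X : PowerSeries R) (c : ℂ) :
    evalSeries X (PowerSeries.C c) = c • (1 : PowerSeries R) := by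
  ext N
  rw [evalSeries, PowerSeries.coeff_mk, Finset.sum_eq_single 0]
  · simp
  · intro q _ hq
    rw [PowerSeries.coeff_C, if_neg hq, zero_smul]
  · simp

theorem evalSeries_one (X : PowerSeries R) : evalSeries X 1 = 1 := by
  simpa using evalSeries_C X 1

/-- `evalSeries` as a homomorphism of algebras. -/
def evalSeriesHom (X : PowerSeries R) (hX : X ∈ orderGE R 1) : PowerSeries ℂ →ₐ[ℂ] PowerSeries R where
  toFun := evalSeries X
  map_one' := evalSeries_one X
  map_mul' := evalSeries_mul hX
  map_zero' := by ext; simp [evalSeries]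
  map_add' := evalSeries_add X
  commutes' c := by
    rw [PowerSeries.algebraMap_eq, evalSeries_C, Algebra.algebraMap_eq_smul_one]

theorem evalSeries_X {X : PowerSeries R} (hX : X ∈ orderGE R 1) :
    evalSeries X PowerSeries.X = X := by
  -- Truncation at `M + 2` retains the monomial `X` for every `M`.
  refine eq_of_sub_mem_orderGE fun M => orderGE_mono (Nat.le_add_right M 2) ?_
  simpa using evalSeries_sub_aeval_mem hX (M + 2) PowerSeries.X

theorem coeff_zero_evalSeries (X : PowerSeries R) (p : PowerSeries ℂ) :
    PowerSeries.coeff 0 (evalSeries X p) = PowerSeries.coeff 0 p • (1 : R) := by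
  simp [evalSeries]

/-- Split `q = r * X ^ M + trunc M q`. The first part yields a multiple of `p ^ M`, which has order
`M`; the polynomial part commutes with the algebra homomorphism `evalSeriesHom`. -/
theorem evalSeries_evalSeries {X : PowerSeries R} (hX : X ∈ orderGE R 1) {p : PowerSeries ℂ}
    (hp : PowerSeries.constantCoeff p = 0) (q : PowerSeries ℂ) :
    evalSeries (evalSeries X p) q = evalSeries X (q.subst p) := by
  have hp' : PowerSeries.coeff 0 p = 0 := by simpa using hp
  have hs : PowerSeries.HasSubst p := PowerSeries.HasSubst.of_constantCoeff_zero' hp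
  have hXp : evalSeries X p ∈ orderGE R 1 :=
    mem_orderGE_one.2 (by rw [coeff_zero_evalSeries, hp', zero_smul])
  refine eq_of_sub_mem_orderGE fun M => ?_
  refine sub_mem_orderGE_trans (evalSeries_sub_aeval_mem hXp M q) ?_
  have h1 : Polynomial.aeval (evalSeries X p) (PowerSeries.trunc M q) =
      evalSeriesHom X hX (Polynomial.aeval p (PowerSeries.trunc M q)) := by
    rw [← Polynomial.aeval_algHom_apply]; rfl
  have h2 : evalSeries X (q.subst p) = evalSeriesHom X hX (q.subst p) := rfl
  rw [h1, h2, ← map_sub]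
  refine evalSeries_mem_orderGE hX ?_
  obtain ⟨r, hr⟩ : ∃ r, q = r * PowerSeries.X ^ M + (PowerSeries.trunc M q : PowerSeries ℂ) :=
    ⟨_, PowerSeries.eq_shift_mul_X_pow_add_trunc M q⟩
  have h3 : q.subst p = r.subst p * p ^ M + Polynomial.aeval p (PowerSeries.trunc M q) := by
    conv_lhs => rw [hr]
    rw [PowerSeries.subst_add hs, PowerSeries.subst_mul hs, PowerSeries.subst_pow hs,
      PowerSeries.subst_X hs, PowerSeries.subst_coe hs]
  rw [h3, sub_add_cancel_right]
  exact neg_mem (mul_mem_orderGE_left _ (pow_mem_orderGE (mem_orderGE_one.2 hp') M))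

theorem evalSeries_smul (X : PowerSeries R) (c : ℂ) (p : PowerSeries ℂ) :
    evalSeries (c • X) p = evalSeries X (PowerSeries.rescale c p) := by
  ext N
  simp only [evalSeries, PowerSeries.coeff_mk, smul_pow, coeff_complex_smul, smul_smul,
    PowerSeries.coeff_rescale]
  exact Finset.sum_congr rfl fun q _ => by rw [mul_comm]

end Substitution

/-! ### Exponential and logarithm -/

section ExpLog

variable {R : Type*} [Ring R] [Algebra ℂ R]

theorem expSeries_eq_evalSeries (X : PowerSeries R) :
    expSeries X = evalSeries X (PowerSeries.exp ℂ) := by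
  ext N
  simp [expSeries, evalSeries, PowerSeries.coeff_exp]

theorem logSeries_eq_evalSeries (Z : PowerSeries R) :
    logSeries Z = evalSeries (Z - 1) (PowerSeries.log ℂ) := by
  ext N
  simp only [logSeries, evalSeries, PowerSeries.coeff_mk]
  rw [← Finset.sum_subset (s₁ := Finset.Icc 1 N) (s₂ := Finset.range (N + 1))]
  · refine Finset.sum_congr rfl fun q hq => ?_
    rw [PowerSeries.coeff_log, if_neg (by simp at hq; omega)]
    simp
  · intro q hq
    simp at hq ⊢
    omega
  · intro q hq hq'
    obtain rfl : q = 0 := by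
      simp at hq hq'
      omega
    simp

/-- The differential equation of the logarithm, from which both inversion formulas between `exp` and
`log` are derived. -/
theorem one_add_X_mul_deriv_log :
    (1 + PowerSeries.X) * PowerSeries.derivative ℂ (PowerSeries.log ℂ) = 1 := by
  rw [PowerSeries.deriv_log]
  ext i
  rw [add_mul, one_mul, map_add]
  cases i with
  | zero => simp
  | succ i => simp [PowerSeries.coeff_succ_X_mul, pow_succ, PowerSeries.coeff_one]

theorem log_subst_exp_sub_one :
    (PowerSeries.log ℂ).subst (PowerSeries.exp ℂ - 1) = PowerSeries.X := by
  have hs : PowerSeries.HasSubst (PowerSeries.exp ℂ - 1) := PowerSeries.HasSubst.exp_sub_one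
  refine PowerSeries.derivative.ext ?_ ?_
  · rw [PowerSeries.derivative_subst hs, map_sub, PowerSeries.derivative_exp,
      PowerSeries.derivative_one, sub_zero, PowerSeries.derivative_X]
    have h := congrArg (PowerSeries.substAlgHom hs) one_add_X_mul_deriv_log
    rw [map_mul, map_add, map_one, PowerSeries.substAlgHom_X, add_sub_cancel,
      PowerSeries.coe_substAlgHom] at h
    rw [mul_comm]; exact h
  · rw [PowerSeries.constantCoeff_X]
    exact PowerSeries.constantCoeff_subst_eq_zero (by
      rw [← PowerSeries.constantCoeff_eq]; simp [PowerSeries.constantCoeff_exp]) _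
      PowerSeries.constantCoeff_log

/-- The substituted series `G` satisfies `(1 + X) G' = G` with constant term `1`. The resulting
recurrence `(i+1) G_(i+1) = (1-i) G_i` gives `G_1 = 1` and stops there. -/
theorem exp_subst_log :
    (PowerSeries.exp ℂ).subst (PowerSeries.log ℂ) = 1 + PowerSeries.X := by
  have hs : PowerSeries.HasSubst (PowerSeries.log ℂ) := PowerSeries.HasSubst.log
  set G := (PowerSeries.exp ℂ).subst (PowerSeries.log ℂ) with hG
  have h1 : (1 + PowerSeries.X) * PowerSeries.derivative ℂ G = G := by
    rw [hG, PowerSeries.derivative_subst hs, PowerSeries.derivative_exp, mul_left_comm,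
      one_add_X_mul_deriv_log, mul_one]
  have h0 : PowerSeries.coeff 0 G = 1 := by
    have h2 : PowerSeries.exp ℂ = (PowerSeries.exp ℂ - 1) + 1 := by ring
    have h3 : G = (PowerSeries.exp ℂ - 1).subst (PowerSeries.log ℂ) + 1 := by
      rw [hG, ← PowerSeries.coe_substAlgHom hs, map_sub, map_one, sub_add_cancel]
    rw [h3, map_add, PowerSeries.coeff_zero_one, PowerSeries.coeff_zero_eq_constantCoeff_apply]
    have h4 := PowerSeries.constantCoeff_subst_eq_zero (a := PowerSeries.log ℂ)
      PowerSeries.constantCoeff_log (PowerSeries.exp ℂ - 1) (by simp [PowerSeries.constantCoeff_exp])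
    rw [← PowerSeries.constantCoeff_eq] at h4
    rw [h4, zero_add]
  have hrec : ∀ i : ℕ, ((i : ℂ) + 1) * PowerSeries.coeff (i + 1) G =
      (1 - i) * PowerSeries.coeff i G := fun i => by
    have h2 := congrArg (PowerSeries.coeff i) h1
    rw [add_mul, one_mul, map_add, PowerSeries.coeff_derivative] at h2
    cases i with
    | zero =>
      rw [PowerSeries.coeff_zero_X_mul] at h2
      push_cast at h2 ⊢
      linear_combination h2
    | succ i =>
      rw [PowerSeries.coeff_succ_X_mul, PowerSeries.coeff_derivative] at h2
      push_cast at h2 ⊢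
      linear_combination h2
  have h2 : ∀ i, PowerSeries.coeff (i + 2) G = 0 := fun i => by
    induction i with
    | zero =>
      have := hrec 1
      norm_num at this
      exact this
    | succ i ih =>
      have := hrec (i + 2)
      rw [ih, mul_zero] at this
      refine (mul_eq_zero.1 this).resolve_left ?_
      norm_cast
  ext i
  match i with
  | 0 => simpa using h0
  | 1 =>
    have := hrec 0
    rw [h0] at this
    simp at this
    simp [this, PowerSeries.coeff_one]
  | i + 2 => simp [h2, PowerSeries.coeff_one, PowerSeries.coeff_X]

theorem coeff_zero_expSeries (X : PowerSeries R) : PowerSeries.coeff 0 (expSeries X) = 1 := by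
  simp [expSeries]

theorem coeff_zero_logSeries (Z : PowerSeries R) : PowerSeries.coeff 0 (logSeries Z) = 0 := by
  simp [logSeries]

theorem logSeries_mem_orderGE (Z : PowerSeries R) : logSeries Z ∈ orderGE R 1 :=
  mem_orderGE_one.2 (coeff_zero_logSeries Z)

theorem logSeries_expSeries {X : PowerSeries R} (hX : X ∈ orderGE R 1) :
    logSeries (expSeries X) = X := by
  have h : expSeries X - 1 = evalSeries X (PowerSeries.exp ℂ - 1) := by
    rw [expSeries_eq_evalSeries]
    exact ((evalSeriesHom X hX).map_sub _ _ |>.trans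
      (congrArg _ (evalSeriesHom X hX).map_one)).symm
  rw [logSeries_eq_evalSeries, h, evalSeries_evalSeries hX (by simp [PowerSeries.constantCoeff_exp]),
    log_subst_exp_sub_one, evalSeries_X hX]

theorem expSeries_logSeries {Z : PowerSeries R} (hZ : PowerSeries.coeff 0 Z = 1) :
    expSeries (logSeries Z) = Z := by
  have h : Z - 1 ∈ orderGE R 1 := mem_orderGE_one.2 (by rw [map_sub, hZ]; simp)
  rw [expSeries_eq_evalSeries, logSeries_eq_evalSeries,
    evalSeries_evalSeries h PowerSeries.constantCoeff_log, exp_subst_log, evalSeries_add,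
    evalSeries_one, evalSeries_X h, add_sub_cancel]

theorem expSeries_smul_mul_expSeries_smul {X : PowerSeries R} (hX : X ∈ orderGE R 1) (a b : ℂ) :
    expSeries (a • X) * expSeries (b • X) = expSeries ((a + b) • X) := by
  simp only [expSeries_eq_evalSeries, evalSeries_smul]
  rw [← evalSeries_mul hX, PowerSeries.exp_mul_exp_eq_exp_add]

theorem expSeries_zero : expSeries (0 : PowerSeries R) = 1 := by
  ext N
  rw [expSeries, PowerSeries.coeff_mk, Finset.sum_eq_single 0]
  · simp
  · intro q _ hq
    simp [hq]
  · simp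

theorem expSeries_mul_expSeries_neg {X : PowerSeries R} (hX : X ∈ orderGE R 1) :
    expSeries X * expSeries (-X) = 1 := by
  have h := expSeries_smul_mul_expSeries_smul hX 1 (-1)
  rwa [one_smul, neg_one_smul, add_neg_cancel, zero_smul, expSeries_zero] at h

/-- A left inverse of `Z = exp (log Z)` must equal the right inverse `exp (-log Z)`. Both time
symmetry and reversal of compositions enter through this. -/
theorem logSeries_eq_neg {Z W : PowerSeries R} (hZ : PowerSeries.coeff 0 Z = 1) (h : W * Z = 1) :
    logSeries W = -logSeries Z := by
  have h1 := expSeries_mul_expSeries_neg (logSeries_mem_orderGE Z)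
  rw [expSeries_logSeries hZ] at h1
  have h2 : W = expSeries (-logSeries Z) := by
    calc W = W * (Z * expSeries (-logSeries Z)) := by rw [h1, mul_one]
      _ = _ := by rw [← mul_assoc, h, one_mul]
  rw [h2, logSeries_expSeries (neg_mem (logSeries_mem_orderGE Z))]

end ExpLog

/-! ### Dilations and coefficientwise homomorphisms -/

section Maps

variable {R R' : Type*} [Ring R] [Algebra ℂ R] [Ring R'] [Algebra ℂ R']

@[simp] theorem coeff_dilate (a : ℂ) (X : PowerSeries R) (m : ℕ) :
    PowerSeries.coeff m (dilate a X) = a ^ m • PowerSeries.coeff m X := by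
  simp [dilate]

theorem dilate_mul (a : ℂ) (X Z : PowerSeries R) : dilate a (X * Z) = dilate a X * dilate a Z := by
  ext m
  rw [coeff_dilate, PowerSeries.coeff_mul, PowerSeries.coeff_mul, Finset.smul_sum]
  refine Finset.sum_congr rfl fun p hp => ?_
  rw [coeff_dilate, coeff_dilate, smul_mul_smul_comm, ← pow_add, Finset.HasAntidiagonal.mem_antidiagonal.1 hp]

theorem dilate_one (a : ℂ) : dilate a (1 : PowerSeries R) = 1 := by
  ext m
  rw [coeff_dilate, PowerSeries.coeff_one]
  split_ifs with h
  · simp [h]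
  · simp

theorem dilate_dilate (a b : ℂ) (X : PowerSeries R) : dilate a (dilate b X) = dilate (a * b) X := by
  ext m
  simp [smul_smul, mul_pow]

theorem dilate_pow (a : ℂ) (X : PowerSeries R) (q : ℕ) : dilate a (X ^ q) = dilate a X ^ q := by
  induction q with
  | zero => simp [dilate_one]
  | succ q ih => rw [pow_succ, dilate_mul, ih, pow_succ]

theorem dilate_evalSeries (a : ℂ) (X : PowerSeries R) (p : PowerSeries ℂ) :
    dilate a (evalSeries X p) = evalSeries (dilate a X) p := by
  ext N
  simp only [coeff_dilate, evalSeries, PowerSeries.coeff_mk, Finset.smul_sum, ← dilate_pow]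
  exact Finset.sum_congr rfl fun q _ => smul_comm _ _ _

theorem dilate_expSeries (a : ℂ) (X : PowerSeries R) :
    dilate a (expSeries X) = expSeries (dilate a X) := by
  simp only [expSeries_eq_evalSeries, dilate_evalSeries]

theorem dilate_logSeries (a : ℂ) (Z : PowerSeries R) :
    dilate a (logSeries Z) = logSeries (dilate a Z) := by
  have : dilate a Z - 1 = dilate a (Z - 1) := by
    conv_lhs => rw [← dilate_one a]
    ext m
    simp only [map_sub, coeff_dilate, smul_sub]
  simp only [logSeries_eq_evalSeries, dilate_evalSeries, this]

theorem dilate_mem_orderGE (a : ℂ) {X : PowerSeries R} {m : ℕ} (hX : X ∈ orderGE R m) :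
    dilate a X ∈ orderGE R m := fun i hi => by rw [coeff_dilate, hX i hi, smul_zero]

variable {f : R →+* R'} {τ : ℂ →+* ℂ}

theorem map_evalSeries (hf : ∀ c r, f (c • r) = τ c • f r) (X : PowerSeries R)
    (p : PowerSeries ℂ) :
    PowerSeries.map f (evalSeries X p) =
      evalSeries (PowerSeries.map f X) (PowerSeries.map τ p) := by
  ext N
  simp [evalSeries, hf, ← map_pow]

/-- The coefficients of `exp` are rational, hence fixed by any ring endomorphism `τ` of `ℂ`.
Semilinear `f` are admitted so that complex conjugation of words is covered along with algebra
homomorphisms. -/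
theorem map_expSeries (hf : ∀ c r, f (c • r) = τ c • f r) (X : PowerSeries R) :
    PowerSeries.map f (expSeries X) = expSeries (PowerSeries.map f X) := by
  rw [expSeries_eq_evalSeries, map_evalSeries hf, PowerSeries.map_exp, expSeries_eq_evalSeries]

theorem map_logSeries (hf : ∀ c r, f (c • r) = τ c • f r) (Z : PowerSeries R) :
    PowerSeries.map f (logSeries Z) = logSeries (PowerSeries.map f Z) := by
  rw [logSeries_eq_evalSeries, map_evalSeries hf, PowerSeries.map_log, logSeries_eq_evalSeries,
    map_sub, map_one]

theorem map_dilate (hf : ∀ c r, f (c • r) = τ c • f r) (a : ℂ) (X : PowerSeries R) :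
    PowerSeries.map f (dilate a X) = dilate (τ a) (PowerSeries.map f X) := by
  ext N
  simp [hf]

theorem map_algHom_expSeries (f : R →ₐ[ℂ] R') (X : PowerSeries R) :
    PowerSeries.map (f : R →+* R') (expSeries X) = expSeries (PowerSeries.map (f : R →+* R') X) :=
  map_expSeries (f := (f : R →+* R')) (τ := RingHom.id ℂ) (fun c r => map_smul f c r) X

theorem map_algHom_dilate (f : R →ₐ[ℂ] R') (a : ℂ) (X : PowerSeries R) :
    PowerSeries.map (f : R →+* R') (dilate a X) = dilate a (PowerSeries.map (f : R →+* R') X) :=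
  map_dilate (f := (f : R →+* R')) (τ := RingHom.id ℂ) (fun c r => map_smul f c r) a X

end Maps

/-! ### Perturbation of the exponential -/

section Perturbation

variable {R : Type*} [Ring R] [Algebra ℂ R]

theorem add_pow_sub_pow_mem {X δ : PowerSeries R} {s : ℕ} (hδ : δ ∈ orderGE R s) (q : ℕ) :
    (X + δ) ^ q - X ^ q ∈ orderGE R s := by
  induction q with
  | zero => simp
  | succ q ih =>
    rw [pow_succ, pow_succ]
    exact mul_sub_mul_mem_orderGE ih (by simpa using hδ)

variable {ι : Type*} {I : Finset ι} {X : PowerSeries R} {δ : ι → PowerSeries R} {s N : ℕ}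

omit [Algebra ℂ R] in
-- Isolates the contribution of the sum of the `δ i`; the last term carries two factors of each
-- individual `δ i`, and so is of second order.
theorem sum_add_pow_succ (I : Finset ι) (X : PowerSeries R) (δ : ι → PowerSeries R) (q : ℕ) :
    ∑ i ∈ I, ((X + δ i) ^ (q + 1) - X ^ (q + 1)) =
      (∑ i ∈ I, ((X + δ i) ^ q - X ^ q)) * X + X ^ q * ∑ i ∈ I, δ i +
        ∑ i ∈ I, ((X + δ i) ^ q - X ^ q) * δ i := by
  rw [Finset.sum_mul, Finset.mul_sum, ← Finset.sum_add_distrib, ← Finset.sum_add_distrib]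
  refine Finset.sum_congr rfl fun i _ => ?_
  rw [pow_succ, pow_succ]
  noncomm_ring

theorem sum_add_pow_sub_pow_mem (hδ : ∀ i ∈ I, δ i ∈ orderGE R s)
    (hN : ∑ i ∈ I, δ i ∈ orderGE R N) (h : N ≤ s + s) (q : ℕ) :
    ∑ i ∈ I, ((X + δ i) ^ q - X ^ q) ∈ orderGE R N := by
  induction q with
  | zero => simp
  | succ q ih =>
    rw [sum_add_pow_succ]
    refine add_mem (add_mem (mul_mem_orderGE_right _ ih) (mul_mem_orderGE_left _ hN)) ?_
    exact Submodule.sum_mem _ fun i hi =>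
      mul_mem_orderGE h (add_pow_sub_pow_mem (hδ i hi) q) (hδ i hi)

/-- From the second power on, each first-order term has an extra factor `X`, which gains one degree.
So only the linear term of the exponential reaches the coefficient of degree `N`. -/
theorem sum_add_pow_sub_pow_mem_succ (hX : X ∈ orderGE R 1) (hδ : ∀ i ∈ I, δ i ∈ orderGE R s)
    (hN : ∑ i ∈ I, δ i ∈ orderGE R N) (h : N + 1 ≤ s + s) (q : ℕ) :
    ∑ i ∈ I, ((X + δ i) ^ (q + 2) - X ^ (q + 2)) ∈ orderGE R (N + 1) := by
  rw [sum_add_pow_succ]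
  refine add_mem (add_mem (mul_mem_orderGE le_rfl ?_ hX) ?_) ?_
  · exact sum_add_pow_sub_pow_mem hδ hN (by omega) _
  · exact mul_mem_orderGE (by omega) (pow_mem_orderGE hX (q + 1)) hN
  · exact Submodule.sum_mem _ fun i hi =>
      mul_mem_orderGE h (add_pow_sub_pow_mem (hδ i hi) _) (hδ i hi)

theorem coeff_sum_expSeries_sub (I : Finset ι) (X : PowerSeries R) (δ : ι → PowerSeries R)
    (m : ℕ) : PowerSeries.coeff m (∑ i ∈ I, (expSeries (X + δ i) - expSeries X)) =
      ∑ q ∈ Finset.range (m + 1), ((q.factorial : ℂ)⁻¹) •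
        PowerSeries.coeff m (∑ i ∈ I, ((X + δ i) ^ q - X ^ q)) := by
  simp only [map_sum, map_sub, expSeries, PowerSeries.coeff_mk, Finset.smul_sum, smul_sub,
    ← Finset.sum_sub_distrib]
  exact Finset.sum_comm

theorem sum_expSeries_sub_mem (hδ : ∀ i ∈ I, δ i ∈ orderGE R s)
    (hN : ∑ i ∈ I, δ i ∈ orderGE R N) (h : N ≤ s + s) :
    ∑ i ∈ I, (expSeries (X + δ i) - expSeries X) ∈ orderGE R N := fun m hm => by
  rw [coeff_sum_expSeries_sub]
  exact Finset.sum_eq_zero fun q _ => by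
    rw [sum_add_pow_sub_pow_mem hδ hN h q m hm, smul_zero]

theorem coeff_sum_expSeries_sub_eq (hX : X ∈ orderGE R 1) (hδ : ∀ i ∈ I, δ i ∈ orderGE R s)
    (hN : ∑ i ∈ I, δ i ∈ orderGE R N) (h : N + 1 ≤ s + s) (h1 : 1 ≤ N) :
    PowerSeries.coeff N (∑ i ∈ I, (expSeries (X + δ i) - expSeries X)) =
      PowerSeries.coeff N (∑ i ∈ I, δ i) := by
  rw [coeff_sum_expSeries_sub, Finset.sum_eq_single 1]
  · simp
  · intro q _ hq
    match q with
    | 0 => simp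
    | 1 => exact absurd rfl hq
    | q + 2 => rw [sum_add_pow_sub_pow_mem_succ hX hδ hN h q N (by omega), smul_zero]
  · intro h2
    exact absurd (Finset.mem_range.2 (by omega)) h2

theorem expSeries_add_sub_mem {η : PowerSeries R} {N : ℕ} (hη : η ∈ orderGE R N) :
    expSeries (X + η) - expSeries X ∈ orderGE R N := by
  simpa using sum_expSeries_sub_mem (I := {()}) (X := X) (δ := fun _ => η) (s := N) (N := N)
    (by simpa using hη) (by simpa using hη) (by omega)

theorem coeff_expSeries_add_sub {η : PowerSeries R} {N : ℕ} (hX : X ∈ orderGE R 1)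
    (hη : η ∈ orderGE R N) (h : 1 ≤ N) :
    PowerSeries.coeff N (expSeries (X + η) - expSeries X) = PowerSeries.coeff N η := by
  simpa using coeff_sum_expSeries_sub_eq (I := {()}) (X := X) (δ := fun _ => η) (s := N) (N := N)
    hX (by simpa using hη) (by simpa using hη) (by omega) h

end Perturbation

/-! ### Moving exponentials to the left -/

section Shift

variable {R : Type*} [Ring R] [Algebra ℂ R] {X Z : PowerSeries R} {d : ℕ → PowerSeries R} {M : ℕ}

/-- Modulo degree `M`, right multiplication by `Z` acts on the `d j` as left multiplication by `X`
plus the shift `j ↦ j + 1`. These two operations commute, so the `q`-th power follows the binomial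
theorem. -/
theorem mul_pow_sub_sum_mem (hd : ∀ j, d j * Z - (X * d j + d (j + 1)) ∈ orderGE R M) (q : ℕ) :
    d 0 * Z ^ q - ∑ p ∈ Finset.HasAntidiagonal.antidiagonal q, q.choose p.1 • (X ^ p.2 * d p.1) ∈
      orderGE R M := by
  induction q with
  | zero => simp
  | succ q ih =>
    rw [Finset.sum_antidiagonal_choose_succ_nsmul (fun j i => X ^ i * d j), pow_succ, ← mul_assoc]
    refine sub_mem_orderGE_trans (G := (∑ p ∈ Finset.HasAntidiagonal.antidiagonal q,
      q.choose p.1 • (X ^ p.2 * d p.1)) * Z) ?_ ?_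
    · rw [← sub_mul]
      exact mul_mem_orderGE_right _ ih
    · rw [Finset.sum_mul, ← Finset.sum_add_distrib, ← Finset.sum_sub_distrib]
      refine Submodule.sum_mem _ fun p hp => ?_
      have h1 : q.choose p.2 = q.choose p.1 := by
        rw [Finset.HasAntidiagonal.mem_antidiagonal] at hp
        exact Nat.choose_symm_of_eq_add (by omega)
      have h2 : q.choose p.1 • (X ^ p.2 * d p.1) * Z - (q.choose p.1 • (X ^ (p.2 + 1) * d p.1) +
          q.choose p.2 • (X ^ p.2 * d (p.1 + 1))) =
          q.choose p.1 • (X ^ p.2 * (d p.1 * Z - (X * d p.1 + d (p.1 + 1)))) := by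
        rw [h1, pow_succ, smul_mul_assoc, ← smul_add, ← smul_sub]
        congr 1
        noncomm_ring
      rw [h2]
      exact nsmul_mem (mul_mem_orderGE_left _ (hd _)) _

theorem expSeries_sub_sum_mem (hX : X ∈ orderGE R 1) (M : ℕ) :
    expSeries X - ∑ q ∈ Finset.range M, ((q.factorial : ℂ)⁻¹) • X ^ q ∈ orderGE R M := by
  intro N hN
  rw [map_sub, sub_eq_zero, expSeries, PowerSeries.coeff_mk, map_sum]
  simp only [coeff_complex_smul]
  refine Finset.sum_subset (fun q hq => ?_) fun q _ hq' => ?_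
  · simp at hq ⊢; omega
  · rw [pow_mem_orderGE hX q N (by simp at hq'; omega), smul_zero]

theorem sum_range_antidiagonal {A : Type*} [AddCommMonoid A] (M : ℕ) (f : ℕ × ℕ → A) :
    ∑ q ∈ Finset.range M, ∑ p ∈ Finset.HasAntidiagonal.antidiagonal q, f p =
      ∑ p ∈ Finset.range M ×ˢ Finset.range M with p.1 + p.2 < M, f p := by
  rw [← Finset.sum_fiberwise_of_maps_to (g := fun p : ℕ × ℕ => p.1 + p.2) (t := Finset.range M)]
  · refine Finset.sum_congr rfl fun q hq => Finset.sum_congr ?_ fun _ _ => rfl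
    ext p
    simp only [Finset.HasAntidiagonal.mem_antidiagonal, Finset.mem_filter, Finset.mem_product,
      Finset.mem_range] at hq ⊢
    omega
  · intro p hp
    simp at hp ⊢
    exact hp.2

theorem inv_factorial_mul_choose (i j : ℕ) :
    (((i + j).factorial : ℂ)⁻¹) * ((i + j).choose i : ℕ) =
      ((i.factorial : ℂ)⁻¹) * ((j.factorial : ℂ)⁻¹) := by
  have h : ((i + j).factorial : ℂ) ≠ 0 := Nat.cast_ne_zero.2 (Nat.factorial_ne_zero _)
  rw [Nat.cast_add_choose, ← mul_div_assoc, inv_mul_cancel₀ h, one_div, mul_inv]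

/-- Dividing the binomial formula by `q!` gives the Cauchy product of `exp X` and `∑ d j / j!`. The
triangular and the square range of indices differ by terms of order at least `M`, since `X ^ i * d
j` has order at least `i + j`. -/
theorem mul_expSeries_sub_mem (hX : X ∈ orderGE R 1) (hZ : Z ∈ orderGE R 1)
    (hd : ∀ j, d j * Z - (X * d j + d (j + 1)) ∈ orderGE R M) (hj : ∀ j, d j ∈ orderGE R j) :
    d 0 * expSeries Z - expSeries X * ∑ j ∈ Finset.range M, ((j.factorial : ℂ)⁻¹) • d j ∈
      orderGE R M := by
  set f : ℕ × ℕ → PowerSeries R := fun p =>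
    (((p.1.factorial : ℂ)⁻¹) * ((p.2.factorial : ℂ)⁻¹)) • (X ^ p.2 * d p.1) with hf
  have h1 : d 0 * expSeries Z - ∑ q ∈ Finset.range M,
      ∑ p ∈ Finset.HasAntidiagonal.antidiagonal q, f p ∈ orderGE R M := by
    refine sub_mem_orderGE_trans (mul_sub_mul_mem_orderGE (F := d 0) (F' := d 0) (by simp)
      (expSeries_sub_sum_mem hZ M)) ?_
    rw [Finset.mul_sum, ← Finset.sum_sub_distrib]
    refine Submodule.sum_mem _ fun q _ => ?_
    have h2 : ∑ p ∈ Finset.HasAntidiagonal.antidiagonal q, f p = ((q.factorial : ℂ)⁻¹) •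
        ∑ p ∈ Finset.HasAntidiagonal.antidiagonal q, q.choose p.1 • (X ^ p.2 * d p.1) := by
      rw [Finset.smul_sum]
      refine Finset.sum_congr rfl fun p hp => ?_
      rw [Finset.HasAntidiagonal.mem_antidiagonal] at hp
      rw [← Nat.cast_smul_eq_nsmul ℂ, smul_smul, ← hp, inv_factorial_mul_choose]
    rw [h2, mul_smul_comm, ← smul_sub]
    exact Submodule.smul_mem _ _ (mul_pow_sub_sum_mem hd q)
  have h3 : (∑ p ∈ Finset.range M ×ˢ Finset.range M, f p) - expSeries X *
      ∑ j ∈ Finset.range M, ((j.factorial : ℂ)⁻¹) • d j ∈ orderGE R M := by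
    have h4 : ∑ p ∈ Finset.range M ×ˢ Finset.range M, f p =
        (∑ q ∈ Finset.range M, ((q.factorial : ℂ)⁻¹) • X ^ q) *
          ∑ j ∈ Finset.range M, ((j.factorial : ℂ)⁻¹) • d j := by
      rw [Finset.sum_product_right, Finset.sum_mul_sum]
      refine Finset.sum_congr rfl fun i _ => Finset.sum_congr rfl fun j _ => ?_
      rw [smul_mul_smul_comm, mul_comm ((i.factorial : ℂ)⁻¹)]
    rw [h4]
    refine mul_sub_mul_mem_orderGE ?_ (by simp)
    rw [← neg_sub]
    exact neg_mem (expSeries_sub_sum_mem hX M)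
  refine sub_mem_orderGE_trans h1 (sub_mem_orderGE_trans ?_ h3)
  have h6 := Finset.sum_filter_add_sum_filter_not (Finset.range M ×ˢ Finset.range M)
    (fun p => p.1 + p.2 < M) f
  rw [sum_range_antidiagonal, ← h6, sub_add_cancel_left]
  refine neg_mem (Submodule.sum_mem _ fun p hp => Submodule.smul_mem _ _ ?_)
  simp only [Finset.mem_filter] at hp
  exact mul_mem_orderGE (by omega) (pow_mem_orderGE hX _) (hj _)

end Shift

/-! ### Series with coefficients in spaces stable under bracketing -/

section Stable

variable {R : Type*} [Ring R] [Algebra ℂ R] (S : ℕ → Submodule ℂ R)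

/-- The series whose coefficient of degree `m` lies in `S m`. -/
def coeffIn : Submodule ℂ (PowerSeries R) where
  carrier := {F | ∀ m, PowerSeries.coeff m F ∈ S m}
  add_mem' ha hb m := by rw [map_add]; exact add_mem (ha m) (hb m)
  zero_mem' m := by simp
  smul_mem' c F hF m := by rw [coeff_complex_smul]; exact Submodule.smul_mem _ _ (hF m)

/-- The series `h A`. -/
def linearSeries (A : R) : PowerSeries R := PowerSeries.monomial 1 A

omit [Algebra ℂ R] in
theorem coeff_linearSeries (A : R) (m : ℕ) :
    PowerSeries.coeff m (linearSeries A) = if m = 1 then A else 0 := by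
  rw [linearSeries, PowerSeries.coeff_monomial]

theorem linearSeries_mem (A : R) : linearSeries A ∈ orderGE R 1 :=
  mem_orderGE_one.2 (by simp [coeff_linearSeries])

variable {S} {s : ℕ} {A : R}

theorem coeffIn_le_orderGE (hS : ∀ m < s, S m = ⊥) : coeffIn S ≤ orderGE R s := fun F hF m hm => by
  have := hF m
  rwa [hS m hm, Submodule.mem_bot] at this

theorem lie_linearSeries_mem (hA : ∀ m, ∀ x ∈ S m, ⁅A, x⁆ ∈ S (m + 1)) (h0 : S 0 = ⊥)
    {F : PowerSeries R} (hF : F ∈ coeffIn S) : ⁅linearSeries A, F⁆ ∈ coeffIn S := by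
  intro m
  have h1 : linearSeries A = PowerSeries.C A * PowerSeries.X := by
    rw [linearSeries, PowerSeries.monomial_eq_C_mul_X_pow, pow_one]
  rw [Ring.lie_def, h1, ← mul_assoc, mul_assoc (PowerSeries.C A), PowerSeries.X_mul, ← mul_assoc,
    map_sub]
  cases m with
  | zero => simp [h0]
  | succ m =>
    rw [PowerSeries.coeff_succ_mul_X, PowerSeries.coeff_succ_mul_X, PowerSeries.coeff_C_mul,
      PowerSeries.coeff_mul_C, ← Ring.lie_def]
    exact hA m _ (hF m)

section

variable (hA : ∀ m, ∀ x ∈ S m, ⁅A, x⁆ ∈ S (m + 1)) (hS : ∀ m < s, S m = ⊥) (hs : 1 ≤ s)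
include hA hS hs

theorem iterate_lie_mem (a : ℂ) {F : PowerSeries R} (hF : F ∈ coeffIn S) (j : ℕ) :
    (fun G => -⁅a • linearSeries A, G⁆)^[j] F ∈ coeffIn S ⊓ orderGE R (j + 1) := by
  induction j with
  | zero => exact ⟨hF, orderGE_mono (by omega) (coeffIn_le_orderGE hS hF)⟩
  | succ j ih =>
    rw [Function.iterate_succ_apply']
    constructor
    · have h1 : ∀ G : PowerSeries R,
          ⁅a • linearSeries A, G⁆ = a • ⁅linearSeries A, G⁆ := fun G => by
        simp [Ring.lie_def, smul_sub]
      rw [h1]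
      exact neg_mem (Submodule.smul_mem _ _ (lie_linearSeries_mem hA (hS 0 hs) ih.1))
    · have h1 : a • linearSeries A ∈ orderGE R 1 := Submodule.smul_mem _ _ (linearSeries_mem A)
      rw [Ring.lie_def]
      exact neg_mem (sub_mem (mul_mem_orderGE (by omega) h1 ih.2)
        (mul_mem_orderGE le_rfl ih.2 h1))

/-- This is `F e^X = e^X (e^(-ad X) F)`: the shift formula with `Z = X` and `d j = (-ad X)^j F`. The
spaces `S m` are stable under bracketing with `A`, so the new factor stays in `coeffIn S`. -/
theorem exists_mul_expSeries (a : ℂ) (M : ℕ) {F : PowerSeries R} (hF : F ∈ coeffIn S) :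
    ∃ G ∈ coeffIn S, F * expSeries (a • linearSeries A) -
      expSeries (a • linearSeries A) * G ∈ orderGE R M := by
  have h1 : a • linearSeries A ∈ orderGE R 1 := Submodule.smul_mem _ _ (linearSeries_mem A)
  have h2 := iterate_lie_mem hA hS hs a hF
  refine ⟨_, ?_, mul_expSeries_sub_mem (M := M)
    (d := fun j => (fun G => -⁅a • linearSeries A, G⁆)^[j] F) h1 h1 (fun j => ?_)
    fun j => orderGE_mono (Nat.le_succ j) (h2 j).2⟩
  · exact Submodule.sum_mem _ fun j _ => Submodule.smul_mem _ _ (h2 j).1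
  · rw [Function.iterate_succ_apply', Ring.lie_def]
    simp

/-- The derivative of the exponential, to first order in `F`: `e^(X+F) = e^X (1 + G)` with `G = ∑
(-ad X)^j F / (j+1)!`, up to products of two elements of order `s`. -/
theorem exists_expSeries_add (a : ℂ) {F : PowerSeries R} (hF : F ∈ coeffIn S) :
    ∃ G ∈ coeffIn S, expSeries (a • linearSeries A + F) -
      expSeries (a • linearSeries A) * (1 + G) ∈ orderGE R (s + s) := by
  have h1 : a • linearSeries A ∈ orderGE R 1 := Submodule.smul_mem _ _ (linearSeries_mem A)
  have hFs := coeffIn_le_orderGE hS hF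
  have h2 := iterate_lie_mem hA hS hs a hF
  -- With `Z = X + F` the sequence `1, F, (-ad X) F, …` satisfies the shift relation exactly at `0`;
  -- afterwards the error is `d (j+1) * F`, of order `2s`.
  set d : ℕ → PowerSeries R := fun j => Nat.casesOn j 1
    fun j => (fun G => -⁅a • linearSeries A, G⁆)^[j] F with hd
  refine ⟨∑ j ∈ Finset.range (s + s - 1), (((j + 1).factorial : ℂ)⁻¹) • d (j + 1), ?_, ?_⟩
  · exact Submodule.sum_mem _ fun j _ => Submodule.smul_mem _ _ (h2 j).1
  have h3 := mul_expSeries_sub_mem (M := s + s) (d := d) h1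
    (add_mem h1 (orderGE_mono hs hFs)) (fun j => ?_) fun j => ?_
  -- The term `j = 0` of the shift formula supplies the summand `1`, which leaves `s + s - 1` terms
  -- for `G`.
  · obtain ⟨t, ht⟩ : ∃ t, s + s = t + 1 := ⟨s + s - 1, by omega⟩
    rw [ht] at h3 ⊢
    rw [Finset.sum_range_succ'] at h3
    simpa [hd, add_comm] using h3
  · cases j with
    | zero => simp [hd]
    | succ j =>
      have h4 : d (j + 1) * (a • linearSeries A + F) - (a • linearSeries A * d (j + 1) +
          d (j + 1 + 1)) = d (j + 1) * F := by
        simp only [hd, Function.iterate_succ_apply', Ring.lie_def]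
        noncomm_ring
      rw [h4]
      exact mul_mem_orderGE le_rfl (coeffIn_le_orderGE hS (h2 j).1) hFs
  · cases j with
    | zero => exact mem_orderGE_zero _
    | succ j => exact (h2 j).2

/-- Moving every factor `exp (a h A)` to the left collects them into one exponential. The
first-order corrections add up, because products of two of them have order `2s`. -/
theorem exists_prod_expSeries (F : ℂ → PowerSeries R)
    (hF : ∀ a, F a - a • linearSeries A ∈ coeffIn S) (l : List ℂ) :
    ∃ G ∈ coeffIn S, (l.map fun a => expSeries (F a)).prod -
      expSeries (l.sum • linearSeries A) * (1 + G) ∈ orderGE R (s + s) := by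
  induction l with
  | nil => exact ⟨0, zero_mem _, by simp [expSeries_zero]⟩
  | cons a l ih =>
    obtain ⟨G, hG, h⟩ := ih
    obtain ⟨G₁, hG₁, h₁⟩ := exists_expSeries_add hA hS hs a (hF a)
    obtain ⟨G₂, hG₂, h₂⟩ := exists_mul_expSeries hA hS hs l.sum (s + s) hG₁
    rw [add_sub_cancel] at h₁
    refine ⟨G₂ + G, add_mem hG₂ hG, ?_⟩
    rw [List.map_cons, List.prod_cons, List.sum_cons]
    refine sub_mem_orderGE_trans (mul_sub_mul_mem_orderGE h₁ h) ?_
    rw [← expSeries_smul_mul_expSeries_smul (linearSeries_mem A)]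
    set P := expSeries (a • linearSeries A)
    set Q := expSeries (l.sum • linearSeries A)
    have h3 : P * (1 + G₁) * (Q * (1 + G)) - P * Q * (1 + (G₂ + G)) =
        P * (G₁ * Q - Q * G₂) * (1 + G) + P * (Q * (G₂ * G)) := by noncomm_ring
    rw [h3]
    refine add_mem (mul_mem_orderGE_right _ (mul_mem_orderGE_left _ h₂)) ?_
    exact mul_mem_orderGE_left _ (mul_mem_orderGE_left _ (mul_mem_orderGE le_rfl
      (coeffIn_le_orderGE hS hG₂) (coeffIn_le_orderGE hS hG)))

/-- Takes the logarithm degree by degree. With `η` the already controlled part of `V - X` below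
degree `m`, the difference `e^V - e^(X+η)` starts with the coefficient `m` of `V - X`, and it agrees
with `e^X (G - G')`, whose leading coefficient lies in `S m`. -/
theorem coeff_sub_mem_of_expSeries {V G : PowerSeries R} (hV : V ∈ orderGE R 1) (a : ℂ)
    (hG : G ∈ coeffIn S)
    (h : expSeries V - expSeries (a • linearSeries A) * (1 + G) ∈ orderGE R (s + s)) (m : ℕ)
    (hm : m < s + s) : PowerSeries.coeff m (V - a • linearSeries A) ∈ S m := by
  set X := a • linearSeries A with hX
  have hX1 : X ∈ orderGE R 1 := Submodule.smul_mem _ _ (linearSeries_mem A)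
  induction m using Nat.strong_induction_on with
  | _ m ih =>
  rcases Nat.eq_zero_or_pos m with rfl | hm0
  · rw [sub_mem hV hX1 0 one_pos]; exact zero_mem _
  set η : PowerSeries R := PowerSeries.mk fun i => if i < m then PowerSeries.coeff i (V - X) else 0
    with hη
  set ρ := V - X - η with hρ
  have hηS : η ∈ coeffIn S := fun i => by
    rw [hη, PowerSeries.coeff_mk]
    split_ifs with hi
    · exact ih i hi (by omega)
    · exact zero_mem _
  have hρm : ρ ∈ orderGE R m := fun i hi => by
    rw [hρ, map_sub _ (V - X), hη, PowerSeries.coeff_mk, if_pos hi, sub_self]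
  have hρc : PowerSeries.coeff m (V - X) = PowerSeries.coeff m ρ := by
    rw [hρ, map_sub _ (V - X), hη, PowerSeries.coeff_mk, if_neg (lt_irrefl m), sub_zero]
  have hV' : V = X + η + ρ := by rw [hρ]; abel
  have hXη : X + η ∈ orderGE R 1 := add_mem hX1 (orderGE_mono hs (coeffIn_le_orderGE hS hηS))
  obtain ⟨G', hG', h'⟩ := exists_expSeries_add hA hS hs a hηS
  rw [← hX] at h'
  have h1 := expSeries_add_sub_mem (X := X + η) hρm
  have h2 := coeff_expSeries_add_sub hXη hρm hm0
  rw [← hV'] at h1 h2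
  have h3 : expSeries X * (G - G') - (expSeries V - expSeries (X + η)) ∈ orderGE R (s + s) := by
    have : expSeries X * (G - G') - (expSeries V - expSeries (X + η)) =
      (expSeries (X + η) - expSeries X * (1 + G')) - (expSeries V - expSeries X * (1 + G)) := by
      noncomm_ring
    rw [this]
    exact sub_mem h' h
  have h4 : expSeries X * (G - G') ∈ orderGE R m := by
    simpa using add_mem (orderGE_mono hm.le h3) h1
  have h5 : G - G' ∈ orderGE R m := by
    have h6 : expSeries (-X) * expSeries X = 1 := by
      simpa using expSeries_mul_expSeries_neg (neg_mem hX1)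
    have := mul_mem_orderGE_left (expSeries (-X)) h4
    rwa [← mul_assoc, h6, one_mul] at this
  have h6 := h3 m hm
  rw [map_sub, sub_eq_zero, h2, coeff_mul_of_mem_orderGE h5, coeff_zero_expSeries, one_mul] at h6
  rw [hρc, ← h6]
  exact sub_mem hG hG' m

end

end Stable

/-! ### Complex conjugation of the coefficients of words -/

section Conjugation

/-- Complex conjugation of the coefficients, fixing the symbols. -/
def wordsConj : Words →+* Words :=
  (FreeAlgebra.equivMonoidAlgebraFreeMonoid (R := ℂ) (X := ℕ)).symm.toRingEquiv.toRingHom.comp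
    ((MonoidAlgebra.mapRingHom (FreeMonoid ℕ) (starRingEnd ℂ)).comp
      (FreeAlgebra.equivMonoidAlgebraFreeMonoid (R := ℂ) (X := ℕ)).toRingEquiv.toRingHom)

theorem wordsConj_apply (w : Words) : wordsConj w =
    (FreeAlgebra.equivMonoidAlgebraFreeMonoid (R := ℂ) (X := ℕ)).symm
      (MonoidAlgebra.mapRingHom (FreeMonoid ℕ) (starRingEnd ℂ)
        (FreeAlgebra.equivMonoidAlgebraFreeMonoid w)) := rfl

theorem wordsConj_Y (m : ℕ) : wordsConj (Y m) = Y m := by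
  have h : FreeAlgebra.equivMonoidAlgebraFreeMonoid (Y m) =
      MonoidAlgebra.single (FreeMonoid.of m) (1 : ℂ) := by
    simp [FreeAlgebra.equivMonoidAlgebraFreeMonoid, Y]
  rw [wordsConj_apply, AlgEquiv.symm_apply_eq, h, MonoidAlgebra.mapRingHom_single, map_one]

theorem wordsConj_smul (c : ℂ) (w : Words) :
    wordsConj (c • w) = starRingEnd ℂ c • wordsConj w := by
  have h : wordsConj (algebraMap ℂ Words c) = algebraMap ℂ Words (starRingEnd ℂ c) := by
    rw [wordsConj_apply, AlgEquiv.symm_apply_eq, AlgEquiv.commutes, AlgEquiv.commutes]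
    simp
  rw [Algebra.smul_def, map_mul, h, ← Algebra.smul_def]

theorem wordsConj_lie (x y : Words) : wordsConj ⁅x, y⁆ = ⁅wordsConj x, wordsConj y⁆ := by
  simp only [Ring.lie_def, map_sub, map_mul]

theorem E_succ (m l : ℕ) :
    E m (l + 1) = (fun X : Words => ⁅Y 1, ⁅Y 1, X⁆⁆)^[l] (Y (m - 2 * l)) := rfl

theorem wordsConj_E (m l : ℕ) : wordsConj (E m (l + 1)) = E m (l + 1) := by
  rw [E_succ]
  generalize Y (m - 2 * l) = Z, wordsConj_Y (m - 2 * l) = hZ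
  induction l with
  | zero => exact hZ
  | succ l ih => rw [Function.iterate_succ_apply', wordsConj_lie, wordsConj_lie, wordsConj_Y, ih]

theorem map_wordsConj_basicSeries (n : ℕ) :
    PowerSeries.map wordsConj (basicSeries n) = basicSeries n := by
  ext m
  simp only [basicSeries, PowerSeries.coeff_map, PowerSeries.coeff_mk]
  split_ifs
  · exact wordsConj_Y m
  · exact map_zero _

theorem map_wordsConj_compSeries (n : ℕ) (α : List ℂ) :
    PowerSeries.map wordsConj (compSeries n α) = compSeries n (α.map star) := by
  rw [compSeries, map_list_prod, List.map_map, compSeries, ← List.map_reverse, List.map_map]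
  congr 2
  ext1 a
  simp only [Function.comp_apply]
  rw [map_expSeries wordsConj_smul, map_dilate wordsConj_smul, map_wordsConj_basicSeries,
    starRingEnd_apply]

theorem map_wordsConj_logCompSeries (n : ℕ) (α : List ℂ) :
    PowerSeries.map wordsConj (logCompSeries n α) = logCompSeries n (α.map star) := by
  rw [logCompSeries, map_logSeries wordsConj_smul, map_wordsConj_compSeries, logCompSeries]

end Conjugation

/-! ### Reversal of compositions -/

section Reversal

theorem coeff_basicSeries (n m : ℕ) : PowerSeries.coeff m (basicSeries n) =
    open Classical in if m = 1 ∨ (2 * n + 1 ≤ m ∧ Odd m) then Y m else 0 := by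
  rw [basicSeries, PowerSeries.coeff_mk]

theorem basicSeries_mem_orderGE (n : ℕ) : basicSeries n ∈ orderGE Words 1 := by
  rw [mem_orderGE_one, coeff_basicSeries, if_neg]
  rintro (h | h)
  · exact absurd h (by norm_num)
  · exact absurd h.1 (by omega)

theorem dilate_neg_one_basicSeries (n : ℕ) : dilate (-1) (basicSeries n) = -basicSeries n := by
  ext m
  rw [coeff_dilate, map_neg, coeff_basicSeries]
  split_ifs with h
  · have hm : Odd m := by
      rcases h with rfl | h
      · exact odd_one
      · exact h.2
    rw [hm.neg_one_pow, neg_one_smul]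
  · simp

theorem compSeries_cons (n : ℕ) (a : ℂ) (α : List ℂ) : compSeries n (a :: α) =
    compSeries n α * expSeries (dilate a (basicSeries n)) := by
  simp [compSeries]

theorem compSeries_append_singleton (n : ℕ) (a : ℂ) (α : List ℂ) : compSeries n (α ++ [a]) =
    expSeries (dilate a (basicSeries n)) * compSeries n α := by
  simp [compSeries]

/-- Because `Y(h)` is odd, `exp Y(-a h)` inverts `exp Y(a h)`, and reversing the list puts the
inverse factors in the order in which they cancel. -/
theorem dilate_compSeries_reverse_mul (n : ℕ) (α : List ℂ) :
    dilate (-1) (compSeries n α.reverse) * compSeries n α = 1 := by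
  induction α with
  | nil => simp [compSeries, dilate_one]
  | cons a α ih =>
    have h := expSeries_mul_expSeries_neg (neg_mem (dilate_mem_orderGE a (basicSeries_mem_orderGE n)))
    rw [neg_neg] at h
    rw [List.reverse_cons, compSeries_append_singleton, compSeries_cons, dilate_mul,
      dilate_expSeries, dilate_dilate, mul_comm (-1 : ℂ) a, ← dilate_dilate,
      dilate_neg_one_basicSeries]
    have h1 : dilate a (-basicSeries n) = -dilate a (basicSeries n) := by
      ext; simp
    rw [h1, mul_assoc, ← mul_assoc _ (compSeries n α), ih, one_mul, h]

theorem coeff_zero_compSeries (n : ℕ) (α : List ℂ) :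
    PowerSeries.coeff 0 (compSeries n α) = 1 := by
  induction α with
  | nil => simp [compSeries]
  | cons a α ih =>
    rw [compSeries_cons, PowerSeries.coeff_mul, Finset.HasAntidiagonal.antidiagonal_zero, Finset.sum_singleton, ih,
      coeff_zero_expSeries, one_mul]

theorem expSeries_logCompSeries (n : ℕ) (α : List ℂ) :
    expSeries (logCompSeries n α) = compSeries n α :=
  expSeries_logSeries (coeff_zero_compSeries n α)

theorem IsConsistentSymConj.map_star {α : List ℂ} (hα : IsConsistentSymConj α) :
    α.map star = α.reverse := by
  conv_lhs => rw [← hα.1]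
  rw [List.map_map, show star ∘ star = (id : ℂ → ℂ) from funext star_star, List.map_id]

/-- For a symmetric-conjugate list conjugation is reversal, so the conjugate composition at `-h` is
the inverse of the original at `h`. Conjugation thus fixes odd coefficients and negates even ones.
-/
theorem coeff_logCompSeries_star (n : ℕ) {α : List ℂ} (hα : IsConsistentSymConj α) (m : ℕ) :
    (-1 : ℂ) ^ m • PowerSeries.coeff m (logCompSeries n (α.map star)) =
      -PowerSeries.coeff m (logCompSeries n α) := by
  have h := logSeries_eq_neg (coeff_zero_compSeries n α) (dilate_compSeries_reverse_mul n α)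
  rw [← dilate_logSeries, ← hα.map_star] at h
  simpa [logCompSeries] using congrArg (PowerSeries.coeff m) h

end Reversal

/-! ### The bracket expansion -/

section Expansion

/-- The span of the brackets `ad^p Y_j` with `j + p = m` for the odd indices `j ≥ 2n+1`. -/
def bracketSpan (n m : ℕ) : Submodule ℂ Words :=
  Submodule.span ℂ {x | ∃ p j, p + j = m ∧ 2 * n + 1 ≤ j ∧ Odd j ∧
    x = (fun X : Words => ⁅Y 1, X⁆)^[p] (Y j)}

theorem lie_mem_bracketSpan {n m : ℕ} {x : Words} (hx : x ∈ bracketSpan n m) :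
    ⁅Y 1, x⁆ ∈ bracketSpan n (m + 1) := by
  induction hx using Submodule.span_induction with
  | mem x hx =>
    obtain ⟨p, j, h, h1, h2, rfl⟩ := hx
    exact Submodule.subset_span ⟨p + 1, j, by omega, h1, h2, by rw [Function.iterate_succ_apply']⟩
  | zero => rw [Ring.lie_def, mul_zero, zero_mul, sub_zero]; exact zero_mem _
  | add x y _ _ hx hy =>
    have h : ⁅Y 1, x + y⁆ = ⁅Y 1, x⁆ + ⁅Y 1, y⁆ := by
      simp only [Ring.lie_def]
      noncomm_ring
    rw [h]
    exact add_mem hx hy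
  | smul c x _ hx =>
    have h : ⁅Y 1, c • x⁆ = c • ⁅Y 1, x⁆ := by
      rw [Ring.lie_def, Ring.lie_def, mul_smul_comm, smul_mul_assoc, smul_sub]
    rw [h]
    exact Submodule.smul_mem _ _ hx

theorem bracketSpan_eq_bot (n m : ℕ) (hm : m < 2 * n + 1) : bracketSpan n m = ⊥ := by
  rw [bracketSpan, Submodule.span_eq_bot]
  rintro x ⟨p, j, h, h1, -⟩
  omega

theorem dilate_basicSeries_sub_mem (n : ℕ) (a : ℂ) :
    dilate a (basicSeries n) - a • linearSeries (Y 1) ∈ coeffIn (bracketSpan n) := by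
  intro m
  rw [map_sub, coeff_dilate, coeff_complex_smul, coeff_linearSeries, coeff_basicSeries]
  by_cases h1 : m = 1
  · simp [h1]
  · rw [if_neg h1, smul_zero, sub_zero]
    split_ifs with h
    · have h' := h.resolve_left h1
      exact Submodule.smul_mem _ _ (Submodule.subset_span ⟨0, m, by omega, h'.1, h'.2, rfl⟩)
    · rw [smul_zero]; exact zero_mem _

/-- The bound `4n+2 = 2(2n+1)` is the first degree in which two higher symbols can be multiplied. -/
theorem coeff_logCompSeries_sub_mem {n : ℕ} (hn : 1 ≤ n) {α : List ℂ} (hα : α.sum = 1) {m : ℕ}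
    (hm : m < 4 * n + 2) :
    PowerSeries.coeff m (logCompSeries n α - linearSeries (Y 1)) ∈ bracketSpan n m := by
  have hA : ∀ m, ∀ x ∈ bracketSpan n m, ⁅Y 1, x⁆ ∈ bracketSpan n (m + 1) :=
    fun m x hx => lie_mem_bracketSpan hx
  obtain ⟨G, hG, h⟩ := exists_prod_expSeries hA (bracketSpan_eq_bot n) (by omega)
    (fun a => dilate a (basicSeries n)) (dilate_basicSeries_sub_mem n) α.reverse
  rw [List.sum_reverse, hα] at h
  have h1 := coeff_sub_mem_of_expSeries (V := logCompSeries n α) hA (bracketSpan_eq_bot n)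
    (by omega) (logSeries_mem_orderGE _) 1 hG (by rw [expSeries_logCompSeries]; exact h) m
    (by omega)
  rwa [one_smul] at h1

theorem logCompSeries_sub_mem_orderGE {n : ℕ} (hn : 1 ≤ n) {α : List ℂ} (hα : α.sum = 1) :
    logCompSeries n α - linearSeries (Y 1) ∈ orderGE Words (2 * n + 1) := fun m hm => by
  have h := coeff_logCompSeries_sub_mem hn hα (m := m) (by omega)
  rwa [bracketSpan_eq_bot n m hm, Submodule.mem_bot] at h

/-- In odd total degree an odd index `j` leaves an even number of brackets with `Y_1`, which group
into the double brackets defining `E`. -/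
theorem bracketSpan_odd_le (n t : ℕ) : bracketSpan n (2 * n + 1 + 2 * t) ≤
    Submodule.span ℂ (Set.range fun l : Fin (t + 1) => E (2 * n + 1 + 2 * t) (l + 1)) := by
  rw [bracketSpan, Submodule.span_le]
  rintro x ⟨p, j, h, h1, ⟨i, hi⟩, rfl⟩
  obtain ⟨l, rfl⟩ : ∃ l, p = 2 * l := ⟨n + t - i, by omega⟩
  refine Submodule.subset_span ⟨⟨l, by omega⟩, ?_⟩
  simp only [E_succ]
  rw [Function.iterate_mul, show 2 * n + 1 + 2 * t - 2 * l = j by omega]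
  rfl

theorem exists_real_expansion {n : ℕ} (hn : 1 ≤ n) {α : List ℂ} (hα : IsConsistentSymConj α)
    (t : ℕ) (ht : t ≤ n) : ∃ ν : Fin (t + 1) → ℝ,
      PowerSeries.coeff (2 * n + 1 + 2 * t) (logCompSeries n α) =
        ∑ l, (ν l : ℂ) • E (2 * n + 1 + 2 * t) (l + 1) := by
  set m := 2 * n + 1 + 2 * t with hm
  set V := PowerSeries.coeff m (logCompSeries n α) with hV
  have h := coeff_logCompSeries_sub_mem hn hα.2 (m := m) (by omega)
  rw [map_sub, coeff_linearSeries, if_neg (by omega), sub_zero] at h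
  obtain ⟨ν, hν⟩ := (Submodule.mem_span_range_iff_exists_fun ℂ).1 (bracketSpan_odd_le n t h)
  have h1 : wordsConj V = V := by
    have h2 := coeff_logCompSeries_star n hα m
    have hodd : Odd m := ⟨n + t, by omega⟩
    rw [hodd.neg_one_pow, neg_one_smul, neg_inj, ← map_wordsConj_logCompSeries,
      PowerSeries.coeff_map] at h2
    exact h2
  -- The coefficient `V` is invariant under conjugation, so averaging any complex expansion with its
  -- conjugate replaces each `ν l` by its real part; no independence of the brackets is needed.
  refine ⟨fun l => (ν l).re, ?_⟩
  have h3 : (2 : ℂ) • V = ∑ l, ((ν l + starRingEnd ℂ (ν l)) • E m (l + 1)) := by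
    simp only [add_smul, Finset.sum_add_distrib]
    have h4 : ∑ l, starRingEnd ℂ (ν l) • E m (l + 1) = V := by
      rw [← h1, hV, ← hν, map_sum]
      exact Finset.sum_congr rfl fun l _ => by rw [wordsConj_smul, wordsConj_E]
    rw [h4, hν, two_smul]
  have h5 : V = (2 : ℂ)⁻¹ • (2 : ℂ) • V := by rw [smul_smul]; norm_num
  rw [h5, h3, Finset.smul_sum]
  refine Finset.sum_congr rfl fun l _ => ?_
  rw [smul_smul, Complex.add_conj]
  push_cast
  rw [inv_mul_cancel_left₀ two_ne_zero]

theorem exists_isBracketExpansion {n : ℕ} (hn : 1 ≤ n) {α : List ℂ}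
    (hα : IsConsistentSymConj α) : ∃ μ, IsBracketExpansion n α μ := by
  obtain ⟨a, ha⟩ := exists_real_expansion hn hα 0 (by omega)
  obtain ⟨b, hb⟩ := exists_real_expansion hn hα 1 hn
  rw [Fin.sum_univ_one] at ha
  rw [Fin.sum_univ_two] at hb
  by_cases h2 : 2 ≤ n
  · obtain ⟨e, he⟩ := exists_real_expansion hn hα 2 h2
    rw [Fin.sum_univ_three] at he
    refine ⟨fun m l => if m = 2 * n + 1 then a 0 else if m = 2 * n + 3 then
      (if l = 1 then b 0 else b 1) else (if l = 1 then e 0 else if l = 2 then e 1 else e 2),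
      by simpa using ha, by simpa using hb, fun _ => by simpa using he⟩
  · exact ⟨fun m l => if m = 2 * n + 1 then a 0 else (if l = 1 then b 0 else b 1),
      by simpa using ha, by simpa using hb, fun h => absurd h h2⟩

end Expansion

/-! ### The defect of a linear combination of compositions -/

section Defect

variable {n k : ℕ}

/-- `∑_j (Ψ^(j) + conj Ψ^(j) - 2 exp(h Y_1))`. -/
def defect (n : ℕ) (α : Fin k → List ℂ) : PowerSeries Words :=
  ∑ j, (compSeries n (α j) + compSeries n ((α j).map star) -
    (2 : ℂ) • expSeries (linearSeries (Y 1)))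

/-- The difference between the logarithm of `Ψ^(j)` or `conj Ψ^(j)` and `h Y_1`. -/
def logDefect (n : ℕ) (α : Fin k → List ℂ) (i : Fin k × Bool) : PowerSeries Words :=
  logCompSeries n (if i.2 then α i.1 else (α i.1).map star) - linearSeries (Y 1)

theorem sum_expSeries_logDefect (α : Fin k → List ℂ) :
    ∑ i, (expSeries (linearSeries (Y 1) + logDefect n α i) - expSeries (linearSeries (Y 1))) =
      defect n α := by
  rw [Fintype.sum_prod_type, defect]
  refine Finset.sum_congr rfl fun j _ => ?_
  simp only [Fintype.sum_bool, logDefect, if_true, add_sub_cancel, expSeries_logCompSeries,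
    two_smul, Bool.false_eq_true, if_false]
  abel

variable {α : Fin k → List ℂ}

theorem logDefect_mem (hn : 1 ≤ n) (hα : ∀ j, IsConsistentSymConj (α j)) (i : Fin k × Bool) :
    logDefect n α i ∈ orderGE Words (2 * n + 1) := by
  refine logCompSeries_sub_mem_orderGE hn ?_
  split_ifs
  · exact (hα i.1).2
  · rw [(hα i.1).map_star, List.sum_reverse, (hα i.1).2]

/-- Each composition cancels against its conjugate. -/
theorem coeff_sum_logDefect_even (hα : ∀ j, IsConsistentSymConj (α j)) {m : ℕ} (hm : Even m) :
    PowerSeries.coeff m (∑ i, logDefect n α i) = 0 := by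
  rw [Fintype.sum_prod_type, map_sum]
  refine Finset.sum_eq_zero fun j _ => ?_
  have h := coeff_logCompSeries_star n (hα j) m
  have h1 : m ≠ 1 := by rintro rfl; exact absurd hm (by decide)
  rw [hm.neg_one_pow, one_smul] at h
  simp only [Fintype.sum_bool, logDefect, map_add, map_sub, if_true, Bool.false_eq_true, if_false,
    h, coeff_linearSeries, if_neg h1]
  abel

theorem coeff_sum_logDefect_odd (hα : ∀ j, IsConsistentSymConj (α j)) {m : ℕ} (hm : Odd m)
    (h1 : m ≠ 1) : PowerSeries.coeff m (∑ i, logDefect n α i) =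
      (2 : ℂ) • ∑ j, PowerSeries.coeff m (logCompSeries n (α j)) := by
  rw [Fintype.sum_prod_type, map_sum, Finset.smul_sum]
  refine Finset.sum_congr rfl fun j _ => ?_
  have h := coeff_logCompSeries_star n (hα j) m
  rw [hm.neg_one_pow, neg_one_smul, neg_inj] at h
  simp only [Fintype.sum_bool, logDefect, map_add, map_sub, if_true, Bool.false_eq_true, if_false,
    h, coeff_linearSeries, if_neg h1, two_smul, sub_zero]

theorem logDefect_mem_of_coeff_eq_zero (hn : 1 ≤ n) (hα : ∀ j, IsConsistentSymConj (α j))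
    (h : ∀ j, PowerSeries.coeff (2 * n + 1) (logCompSeries n (α j)) = 0) (i : Fin k × Bool) :
    logDefect n α i ∈ orderGE Words (2 * n + 2) := by
  intro m hm
  rcases Nat.lt_or_ge m (2 * n + 1) with h1 | h1
  · exact logDefect_mem hn hα i m h1
  · obtain rfl : m = 2 * n + 1 := by omega
    rw [logDefect, map_sub, coeff_linearSeries, if_neg (c := 2 * n + 1 = 1) (by omega), sub_zero]
    split_ifs
    · exact h _
    · rw [← map_wordsConj_logCompSeries, PowerSeries.coeff_map, h, map_zero]

/-- If the logarithms agree with `h Y_1` up to order `s` and, on average, up to order `r`, then the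
linear combination agrees with `exp(h Y_1)` up to order `r`, as long as `r < 2s`. -/
theorem defect_mem_of_sum_mem {s r : ℕ} (hs : ∀ i, logDefect n α i ∈ orderGE Words s)
    (hr : ∑ i, logDefect n α i ∈ orderGE Words r) (h : r ≤ s + s) :
    defect n α ∈ orderGE Words r := by
  rw [← sum_expSeries_logDefect]
  exact sum_expSeries_sub_mem (fun i _ => hs i) hr h

/-- The second-order terms begin in degree `2(2n+1) = 4n+2`, beyond `m`. -/
theorem coeff_defect_eq (hn : 1 ≤ n) (hα : ∀ j, IsConsistentSymConj (α j)) {m : ℕ}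
    (hm : m ≤ 4 * n + 1) (h1 : 1 ≤ m) (h : ∑ i, logDefect n α i ∈ orderGE Words m) :
    PowerSeries.coeff m (defect n α) = PowerSeries.coeff m (∑ i, logDefect n α i) := by
  rw [← sum_expSeries_logDefect]
  exact coeff_sum_expSeries_sub_eq (linearSeries_mem _) (fun i _ => logDefect_mem hn hα i) h
    (by omega) h1

variable {μ : Fin k → ℕ → ℕ → ℝ}

theorem coeff_sum_logDefect_one (hn : 1 ≤ n) (hα : ∀ j, IsConsistentSymConj (α j))
    (hμ : ∀ j, IsBracketExpansion n (α j) (μ j)) :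
    PowerSeries.coeff (2 * n + 1) (∑ i, logDefect n α i) =
      (2 : ℂ) • ((c μ (2 * n + 1) 1 : ℂ) • E (2 * n + 1) 1) := by
  rw [coeff_sum_logDefect_odd hα ⟨n, rfl⟩ (by omega)]
  simp only [(hμ _).deg_one, c, Complex.ofReal_sum, Finset.sum_smul]

theorem coeff_sum_logDefect_three (hα : ∀ j, IsConsistentSymConj (α j))
    (hμ : ∀ j, IsBracketExpansion n (α j) (μ j)) :
    PowerSeries.coeff (2 * n + 3) (∑ i, logDefect n α i) =
      (2 : ℂ) • ((c μ (2 * n + 3) 1 : ℂ) • E (2 * n + 3) 1 +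
        (c μ (2 * n + 3) 2 : ℂ) • E (2 * n + 3) 2) := by
  rw [coeff_sum_logDefect_odd hα ⟨n + 1, by ring⟩ (by omega)]
  simp only [(hμ _).deg_three, c, Complex.ofReal_sum, Finset.sum_smul, Finset.sum_add_distrib]

theorem coeff_sum_logDefect_five (h2 : 2 ≤ n) (hα : ∀ j, IsConsistentSymConj (α j))
    (hμ : ∀ j, IsBracketExpansion n (α j) (μ j)) :
    PowerSeries.coeff (2 * n + 5) (∑ i, logDefect n α i) =
      (2 : ℂ) • ((c μ (2 * n + 5) 1 : ℂ) • E (2 * n + 5) 1 +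
        (c μ (2 * n + 5) 2 : ℂ) • E (2 * n + 5) 2 +
          (c μ (2 * n + 5) 3 : ℂ) • E (2 * n + 5) 3) := by
  rw [coeff_sum_logDefect_odd hα ⟨n + 2, by ring⟩ (by omega)]
  simp only [(hμ _).deg_five h2, c, Complex.ofReal_sum, Finset.sum_smul, Finset.sum_add_distrib]

end Defect

/-! ### Asymptotic expansions -/

section Asymptotics

/-- Integration of a bound on the derivative with respect to the first variable. -/
theorem isBigO_pow_succ_of_hasDerivAt {𝕜 E G : Type*} [RCLike 𝕜] [NormedAddCommGroup E]
    [NormedAddCommGroup G] [NormedSpace 𝕜 G] {H H' : 𝕜 × E → G} {x : E} {N : ℕ}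
    (hH : ∀ᶠ p in 𝓝 ((0 : 𝕜), x), HasDerivAt (fun h => H (h, p.2)) (H' p) p.1)
    (h0 : ∀ z, H (0, z) = 0) (hO : H' =O[𝓝 ((0 : 𝕜), x)] fun p => p.1 ^ N) :
    H =O[𝓝 ((0 : 𝕜), x)] fun p => p.1 ^ (N + 1) := by
  obtain ⟨C, hC0, hC⟩ := hO.exists_nonneg
  obtain ⟨ε, hε, hball⟩ := Metric.eventually_nhds_iff_ball.1 (hH.and hC.bound)
  refine Asymptotics.IsBigO.of_bound C ?_
  filter_upwards [Metric.ball_mem_nhds ((0 : 𝕜), x) hε] with p hp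
  have hmem : ∀ t ∈ Metric.closedBall (0 : 𝕜) ‖p.1‖, (t, p.2) ∈ Metric.ball ((0 : 𝕜), x) ε := by
    intro t ht
    rw [mem_closedBall_zero_iff] at ht
    rw [Metric.mem_ball, Prod.dist_eq, max_lt_iff] at hp ⊢
    simp only [dist_zero_right] at hp ⊢
    exact ⟨ht.trans_lt hp.1, hp.2⟩
  have h1 := Convex.norm_image_sub_le_of_norm_hasDerivWithin_le
    (f := fun t => H (t, p.2)) (f' := fun t => H' (t, p.2)) (s := Metric.closedBall (0 : 𝕜) ‖p.1‖)
    (x := 0) (y := p.1) (C := C * ‖p.1‖ ^ N)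
    (fun t ht => (hball _ (hmem t ht)).1.hasDerivWithinAt) (fun t ht => ?_)
    (convex_closedBall _ _) (by simp) (by simp)
  · rw [h0, sub_zero, sub_zero, mul_assoc, ← pow_succ, ← norm_pow] at h1
    exact h1
  · refine (hball _ (hmem t ht)).2.trans ?_
    rw [norm_pow]
    rw [mem_closedBall_zero_iff] at ht
    gcongr

/-- The function `u` has the asymptotic expansion `∑_m h^m a_m` as `h → 0`. -/
def HasExpansion (u : ℝ → ℂ) (a : ℕ → ℂ) : Prop :=
  ∀ N, (fun h : ℝ => u h - ∑ m ∈ Finset.range N, (h : ℂ) ^ m * a m) =O[𝓝 0] fun h : ℝ => h ^ N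

namespace HasExpansion

variable {u v : ℝ → ℂ} {a b : ℕ → ℂ}

theorem add (hu : HasExpansion u a) (hv : HasExpansion v b) :
    HasExpansion (fun h => u h + v h) (fun m => a m + b m) := fun N => by
  refine ((hu N).add (hv N)).congr_left fun h => ?_
  simp only [mul_add, Finset.sum_add_distrib]
  ring

theorem const_mul (hu : HasExpansion u a) (z : ℂ) :
    HasExpansion (fun h => z * u h) (fun m => z * a m) := fun N => by
  refine ((hu N).const_mul_left z).congr_left fun h => ?_
  rw [mul_sub, Finset.mul_sum]
  congr 1
  exact Finset.sum_congr rfl fun m _ => mul_left_comm _ _ _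

theorem sub (hu : HasExpansion u a) (hv : HasExpansion v b) :
    HasExpansion (fun h => u h - v h) (fun m => a m - b m) := by
  simpa [sub_eq_add_neg] using hu.add (hv.const_mul (-1))

theorem sum {ι : Type*} {I : Finset ι} {u : ι → ℝ → ℂ} {a : ι → ℕ → ℂ}
    (h : ∀ i ∈ I, HasExpansion (u i) (a i)) :
    HasExpansion (fun h => ∑ i ∈ I, u i h) (fun m => ∑ i ∈ I, a i m) := fun N => by
  refine (Asymptotics.IsBigO.fun_sum fun i hi => h i hi N).congr_left fun t => ?_
  rw [Finset.sum_sub_distrib, Finset.sum_comm]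
  congr 1
  exact Finset.sum_congr rfl fun m _ => (Finset.mul_sum _ _ _).symm

theorem congr (hu : HasExpansion u a) (h : ∀ᶠ t in 𝓝 (0 : ℝ), u t = v t) : HasExpansion v a :=
  fun N => (hu N).congr' (h.mono fun t ht => by simp only [ht]) EventuallyEq.rfl

end HasExpansion

/-- The constant coefficient is the limit at `0`; once it vanishes, one factor `h` can be divided
out. The punctured neighbourhood is what permits this division in the induction. -/
theorem coeff_eq_zero_of_isBigO (N : ℕ) : ∀ a : ℕ → ℂ,
    ((fun h : ℝ => ∑ m ∈ Finset.range N, (h : ℂ) ^ m * a m) =O[𝓝[≠] 0] fun h : ℝ => h ^ N) →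
      ∀ m < N, a m = 0 := by
  induction N with
  | zero => simp
  | succ N ih =>
    intro a ha
    have hlim : Tendsto (fun h : ℝ => ∑ m ∈ Finset.range (N + 1), (h : ℂ) ^ m * a m) (𝓝[≠] 0)
        (𝓝 (a 0)) := by
      have hc : Continuous fun h : ℝ => ∑ m ∈ Finset.range (N + 1), (h : ℂ) ^ m * a m := by
        fun_prop
      have := (hc.tendsto 0).mono_left (nhdsWithin_le_nhds (s := {0}ᶜ))
      simpa [Finset.sum_range_succ'] using this
    have hzero : Tendsto (fun h : ℝ => h ^ (N + 1)) (𝓝[≠] 0) (𝓝 0) := by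
      have hc : Continuous fun h : ℝ => h ^ (N + 1) := by fun_prop
      simpa using (hc.tendsto 0).mono_left (nhdsWithin_le_nhds (s := {0}ᶜ))
    have h0 : a 0 = 0 := tendsto_nhds_unique hlim (ha.trans_tendsto hzero)
    have h1 := ih (fun m => a (m + 1)) ?_
    · intro m hm
      cases m with
      | zero => exact h0
      | succ m => exact h1 m (by omega)
    · obtain ⟨C, hC⟩ := ha.bound
      refine Asymptotics.IsBigO.of_bound C ?_
      filter_upwards [hC, self_mem_nhdsWithin] with h hh hne
      have hpos : 0 < ‖(h : ℂ)‖ := by simpa using hne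
      rw [Finset.sum_range_succ', h0, mul_zero, add_zero] at hh
      have h2 : ∑ m ∈ Finset.range N, (h : ℂ) ^ (m + 1) * a (m + 1) =
          h * ∑ m ∈ Finset.range N, (h : ℂ) ^ m * a (m + 1) := by
        rw [Finset.mul_sum]
        exact Finset.sum_congr rfl fun m _ => by ring
      have h3 : ‖h ^ (N + 1)‖ = ‖(h : ℂ)‖ * ‖h ^ N‖ := by
        rw [pow_succ, norm_mul, mul_comm, Complex.norm_real]
      rw [h2, h3, norm_mul, mul_left_comm] at hh
      exact le_of_mul_le_mul_left hh hpos

theorem HasExpansion.isBigO_iff {u : ℝ → ℂ} {a : ℕ → ℂ} (hu : HasExpansion u a) (N : ℕ) :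
    (u =O[𝓝 0] fun h : ℝ => h ^ N) ↔ ∀ m < N, a m = 0 := by
  constructor
  · intro h
    refine coeff_eq_zero_of_isBigO N a (Asymptotics.IsBigO.mono ?_ nhdsWithin_le_nhds)
    refine (h.sub (hu N)).congr_left fun t => ?_
    rw [sub_sub_cancel]
  · intro h
    refine (hu N).congr_left fun t => ?_
    rw [Finset.sum_eq_zero fun m hm => by rw [h m (Finset.mem_range.1 hm), mul_zero], sub_zero]

theorem HasExpansion.unique {u : ℝ → ℂ} {a b : ℕ → ℂ} (ha : HasExpansion u a)
    (hb : HasExpansion u b) (m : ℕ) : a m = b m := by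
  have h := (ha.sub hb).isBigO_iff (m + 1) |>.1 (by simpa using Asymptotics.isBigO_zero _ _) m
    (by omega)
  exact sub_eq_zero.1 h

/-- Taylor expansion with respect to the first variable, locally uniformly in the second one. -/
theorem isBigO_sub_taylor {d : ℕ} {x : Fin d → ℂ} (N : ℕ) :
    ∀ F : ℂ × (Fin d → ℂ) → ℂ, AnalyticAt ℂ F (0, x) →
      (fun p : ℂ × (Fin d → ℂ) => F p - ∑ m ∈ Finset.range N, p.1 ^ m *
        (((m.factorial : ℂ)⁻¹) * iteratedDeriv m (fun h => F (h, p.2)) 0)) =O[𝓝 (0, x)]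
          fun p => p.1 ^ N := by
  induction N with
  | zero =>
    intro F hF
    simpa using hF.continuousAt.tendsto.isBigO_one ℂ
  | succ N ih =>
    intro F hF
    -- The remainder of length `N + 1` for `F` has as derivative the remainder of length `N` for
    -- `G`, so the bound follows by integration.
    set G : ℂ × (Fin d → ℂ) → ℂ := fun p => deriv (fun h => F (h, p.2)) p.1 with hG
    have hGa : AnalyticAt ℂ G (0, x) := by
      simpa [iteratedDeriv_one] using analyticAt_iteratedDeriv_fst hF 1
    refine isBigO_pow_succ_of_hasDerivAt (H' := fun p => G p - ∑ m ∈ Finset.range N, p.1 ^ m *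
        (((m.factorial : ℂ)⁻¹) * iteratedDeriv m (fun h => G (h, p.2)) 0)) ?_ (fun z => ?_) (ih G hGa)
    · filter_upwards [hF.eventually_analyticAt] with p hp
      have h1 : HasDerivAt (fun h => F (h, p.2)) (G p) p.1 := by
        have h2 : HasDerivAt (fun h : ℂ => (h, p.2)) ((1 : ℂ), (0 : Fin d → ℂ)) p.1 :=
          (hasDerivAt_id p.1).prodMk (hasDerivAt_const p.1 p.2)
        have h3 : HasFDerivAt F (fderiv ℂ F p) (p.1, p.2) := hp.differentiableAt.hasFDerivAt
        exact (h3.comp_hasDerivAt p.1 h2).differentiableAt.hasDerivAt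
      have h2 : ∀ m ∈ Finset.range N, HasDerivAt (fun h : ℂ => h ^ (m + 1) *
          ((((m + 1).factorial : ℂ)⁻¹) * iteratedDeriv (m + 1) (fun h => F (h, p.2)) 0))
          (p.1 ^ m * (((m.factorial : ℂ)⁻¹) * iteratedDeriv m (fun h => G (h, p.2)) 0)) p.1 := by
        intro m _
        refine ((hasDerivAt_pow (m + 1) p.1).mul_const _).congr_deriv ?_
        have h5 : iteratedDeriv (m + 1) (fun h => F (h, p.2)) 0 =
            iteratedDeriv m (fun h => G (h, p.2)) 0 := by rw [iteratedDeriv_succ']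
        have h6 : ((m + 1 : ℕ) : ℂ) ≠ 0 := Nat.cast_ne_zero.2 (by omega)
        have h7 : (m.factorial : ℂ) ≠ 0 := Nat.cast_ne_zero.2 (Nat.factorial_ne_zero m)
        rw [h5, Nat.factorial_succ, Nat.cast_mul, Nat.add_sub_cancel]
        field_simp
      have h3 := h1.sub ((HasDerivAt.fun_sum h2).add_const
        (p.1 ^ 0 * (((Nat.factorial 0 : ℂ)⁻¹) * iteratedDeriv 0 (fun h => F (h, p.2)) 0)))
      refine h3.congr_of_eventuallyEq (Eventually.of_forall fun h => ?_)
      simp only [Finset.sum_range_succ', pow_zero]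
      rfl
    · simp [Finset.sum_range_succ']

end Asymptotics

/-! ### Operator series representing maps -/

namespace BasicIntegrator

variable {n d : ℕ} (B : BasicIntegrator n d)

/-- `g(φ_h(x)) = ∑_m h^m (P_m g)(x)` asymptotically, locally uniformly in `x`. -/
structure Represents (P : PowerSeries (Module.End ℂ B.functions))
    (φ : ℂ → (Fin d → ℂ) → (Fin d → ℂ)) : Prop where
  tendsto : ∀ x ∈ B.U, Tendsto (fun p : ℂ × (Fin d → ℂ) => φ p.1 p.2) (𝓝 (0, x)) (𝓝 x)
  isBigO : ∀ x ∈ B.U, ∀ (g : B.functions) (N : ℕ),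
    (fun p : ℂ × (Fin d → ℂ) => g.1 (φ p.1 p.2) -
      ∑ m ∈ Finset.range N, p.1 ^ m * (PowerSeries.coeff m P g).1 p.2) =O[𝓝 (0, x)]
        fun p => p.1 ^ N

variable {B}

theorem functions_isBigO_one (g : B.functions) {x : Fin d → ℂ} (hx : x ∈ B.U) {A : Type*}
    {l : Filter A} {u : A → Fin d → ℂ} (hu : Tendsto u l (𝓝 x)) :
    (fun a => g.1 (u a)) =O[l] fun _ => (1 : ℂ) :=
  ((g.2.1 x hx).continuousAt.tendsto.comp hu).isBigO_one ℂ

theorem tendsto_snd (x : Fin d → ℂ) :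
    Tendsto (fun p : ℂ × (Fin d → ℂ) => p.2) (𝓝 (0, x)) (𝓝 x) :=
  continuous_snd.tendsto ((0 : ℂ), x)

theorem isBigO_pow_of_le (x : Fin d → ℂ) {N M : ℕ} (h : N ≤ M) :
    (fun p : ℂ × (Fin d → ℂ) => p.1 ^ M) =O[𝓝 (0, x)] fun p => p.1 ^ N := by
  have h1 : (fun p : ℂ × (Fin d → ℂ) => p.1 ^ (M - N)) =O[𝓝 (0, x)] fun _ => (1 : ℂ) := by
    have hc : Continuous fun p : ℂ × (Fin d → ℂ) => p.1 ^ (M - N) := by fun_prop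
    exact (hc.tendsto _).isBigO_one ℂ
  refine ((Asymptotics.isBigO_refl (fun p : ℂ × (Fin d → ℂ) => p.1 ^ N) _).mul h1).congr
    (fun p => ?_) fun p => mul_one _
  rw [← pow_add, Nat.add_sub_cancel' h]

theorem represents_one : B.Represents 1 fun _ x => x where
  tendsto x _ := tendsto_snd x
  isBigO x hx g N := by
    cases N with
    | zero => simpa using functions_isBigO_one g hx (tendsto_snd x)
    | succ N =>
      refine (Asymptotics.isBigO_zero _ _).congr_left fun p => ?_
      rw [Finset.sum_range_succ', Finset.sum_eq_zero fun m _ => ?_]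
      · simp
      · rw [PowerSeries.coeff_one, if_neg (Nat.succ_ne_zero m)]
        simp

/-- First expand `g ∘ φ` at the moving point `ψ_h(x)`, which is where local uniformity is needed,
then expand each coefficient function along `ψ`. The operator of the inner map therefore ends up on
the left. -/
theorem Represents.comp {P Q : PowerSeries (Module.End ℂ B.functions)}
    {φ ψ : ℂ → (Fin d → ℂ) → (Fin d → ℂ)} (hφ : B.Represents P φ) (hψ : B.Represents Q ψ) :
    B.Represents (Q * P) fun h => φ h ∘ ψ h where
  tendsto x hx := (hφ.tendsto x hx).comp
    (Tendsto.prodMk_nhds (continuous_fst.tendsto ((0 : ℂ), x)) (hψ.tendsto x hx))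
  isBigO x hx g N := by
    have hlim : Tendsto (fun p : ℂ × (Fin d → ℂ) => (p.1, ψ p.1 p.2)) (𝓝 (0, x)) (𝓝 (0, x)) :=
      Tendsto.prodMk_nhds (continuous_fst.tendsto ((0 : ℂ), x)) (hψ.tendsto x hx)
    have hA := (hφ.isBigO x hx g N).comp_tendsto hlim
    have hB : (fun p : ℂ × (Fin d → ℂ) => ∑ m ∈ Finset.range N, p.1 ^ m *
        ((PowerSeries.coeff m P g).1 (ψ p.1 p.2) - ∑ j ∈ Finset.range N, p.1 ^ j *
          (PowerSeries.coeff j Q (PowerSeries.coeff m P g)).1 p.2)) =O[𝓝 (0, x)]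
          fun p => p.1 ^ N := by
      refine Asymptotics.IsBigO.fun_sum fun m _ => ?_
      have h1 := (isBigO_pow_of_le x (Nat.zero_le m)).mul
        (hψ.isBigO x hx (PowerSeries.coeff m P g) N)
      exact h1.congr_right fun p => by rw [pow_zero, one_mul]
    set f : ℂ × (Fin d → ℂ) → ℕ × ℕ → ℂ := fun p q => p.1 ^ (q.1 + q.2) *
      (PowerSeries.coeff q.1 Q (PowerSeries.coeff q.2 P g)).1 p.2 with hf
    have hC : (fun p : ℂ × (Fin d → ℂ) => ∑ q ∈ Finset.range N ×ˢ Finset.range N with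
        ¬ q.1 + q.2 < N, f p q) =O[𝓝 (0, x)] fun p => p.1 ^ N := by
      refine Asymptotics.IsBigO.fun_sum fun q hq => ?_
      rw [Finset.mem_filter, not_lt] at hq
      have h1 := (isBigO_pow_of_le x hq.2).mul (functions_isBigO_one
        (PowerSeries.coeff q.1 Q (PowerSeries.coeff q.2 P g)) hx (tendsto_snd x))
      exact h1.congr_right fun p => mul_one _
    refine ((hA.add hB).add hC).congr_left fun p => ?_
    have h1 : ∑ m ∈ Finset.range N, p.1 ^ m * (PowerSeries.coeff m (Q * P) g).1 p.2 =
        ∑ q ∈ Finset.range N ×ˢ Finset.range N with q.1 + q.2 < N, f p q := by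
      rw [← sum_range_antidiagonal]
      refine Finset.sum_congr rfl fun m _ => ?_
      rw [PowerSeries.coeff_mul, LinearMap.sum_apply, Submodule.coe_sum, Finset.sum_apply,
        Finset.mul_sum]
      refine Finset.sum_congr rfl fun q hq => ?_
      rw [Finset.HasAntidiagonal.mem_antidiagonal] at hq
      rw [hf, ← hq]
      rfl
    have h2 : ∑ m ∈ Finset.range N, p.1 ^ m * ∑ j ∈ Finset.range N, p.1 ^ j *
        (PowerSeries.coeff j Q (PowerSeries.coeff m P g)).1 p.2 =
        ∑ q ∈ Finset.range N ×ˢ Finset.range N, f p q := by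
      rw [Finset.sum_product_right]
      refine Finset.sum_congr rfl fun m _ => ?_
      rw [Finset.mul_sum]
      refine Finset.sum_congr rfl fun j _ => ?_
      rw [hf, ← mul_assoc, ← pow_add, add_comm m j]
    rw [h1]
    simp only [mul_sub, Finset.sum_sub_distrib]
    rw [h2, ← Finset.sum_filter_add_sum_filter_not (Finset.range N ×ˢ Finset.range N)
      (fun q => q.1 + q.2 < N)]
    simp only [Function.comp_apply]
    ring

theorem Represents.hasExpansion {P : PowerSeries (Module.End ℂ B.functions)}
    {φ : ℂ → (Fin d → ℂ) → (Fin d → ℂ)} (hφ : B.Represents P φ) {x : Fin d → ℂ} (hx : x ∈ B.U)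
    (g : B.functions) : HasExpansion (fun h => g.1 (φ h x))
      fun m => (PowerSeries.coeff m P g).1 x := fun N => by
  have hlim : Tendsto (fun h : ℝ => ((h : ℂ), x)) (𝓝 0) (𝓝 (0, x)) := by
    have hc : Continuous fun h : ℝ => ((h : ℂ), x) := by fun_prop
    simpa using hc.tendsto 0
  refine ((hφ.isBigO x hx g N).comp_tendsto hlim).trans ?_
  refine Asymptotics.IsBigO.of_bound 1 (Eventually.of_forall fun h => ?_)
  simp

theorem taylor_apply (m : ℕ) (g : B.functions) {x : Fin d → ℂ} (hx : x ∈ B.U) :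
    (B.taylor m g).1 x = ((m.factorial : ℂ)⁻¹) * iteratedDeriv m (fun h => g.1 (B.S h x)) 0 :=
  by simp [taylor, hx]

theorem functions_ext {g₁ g₂ : B.functions} (h : ∀ x ∈ B.U, g₁.1 x = g₂.1 x) : g₁ = g₂ := by
  refine Subtype.ext (funext fun x => ?_)
  by_cases hx : x ∈ B.U
  · exact h x hx
  · rw [g₁.2.2 x hx, g₂.2.2 x hx]

theorem represents_S : B.Represents (PowerSeries.mk B.taylor) B.S where
  tendsto x hx := by
    have h := (B.analytic_S x hx).continuousAt.tendsto
    simp only at h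
    rwa [B.S_zero x hx] at h
  isBigO x hx g N := by
    refine (isBigO_sub_taylor N _ (B.analyticAt_comp_S g hx)).congr' ?_ EventuallyEq.rfl
    filter_upwards [(tendsto_snd x).eventually (B.isOpen_U.mem_nhds hx)] with p hp
    simp only [PowerSeries.coeff_mk, taylor_apply _ _ hp]

theorem Represents.dilate {P : PowerSeries (Module.End ℂ B.functions)}
    {φ : ℂ → (Fin d → ℂ) → (Fin d → ℂ)} (hφ : B.Represents P φ) (a : ℂ) :
    B.Represents (dilate a P) fun h => φ (a * h) := by
  have hlim : ∀ x : Fin d → ℂ, Tendsto (fun p : ℂ × (Fin d → ℂ) => (a * p.1, p.2)) (𝓝 (0, x))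
      (𝓝 (0, x)) := fun x => by
    have hc : Continuous fun p : ℂ × (Fin d → ℂ) => (a * p.1, p.2) := by fun_prop
    simpa using hc.tendsto (0, x)
  refine ⟨fun x hx => (hφ.tendsto x hx).comp (hlim x), fun x hx g N => ?_⟩
  have h := (hφ.isBigO x hx g N).comp_tendsto (hlim x)
  refine (h.congr_left fun p => ?_).trans ?_
  · simp only [Function.comp_apply]
    congr 1
    refine Finset.sum_congr rfl fun m _ => ?_
    have h1 : PowerSeries.coeff m (SymConj.dilate a P) = a ^ m • PowerSeries.coeff m P :=
      coeff_dilate a P m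
    rw [h1, mul_pow, LinearMap.smul_apply, Submodule.coe_smul, Pi.smul_apply, smul_eq_mul]
    ring
  · refine Asymptotics.IsBigO.of_bound (‖a‖ ^ N) (Eventually.of_forall fun p => ?_)
    simp [mul_pow]

end BasicIntegrator

/-! ### Exponentials of linear series and stability of the logarithm -/

theorem coeff_expSeries_linearSeries {R : Type*} [Ring R] [Algebra ℂ R] (A : R) (m : ℕ) :
    PowerSeries.coeff m (expSeries (linearSeries A)) = ((m.factorial : ℂ)⁻¹) • A ^ m := by
  have hpow : ∀ q, linearSeries A ^ q = PowerSeries.monomial q (A ^ q) := fun q => by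
    induction q with
    | zero => simp
    | succ q ih =>
      rw [pow_succ, ih, linearSeries, PowerSeries.monomial_mul_monomial, pow_succ]
  rw [expSeries, PowerSeries.coeff_mk, Finset.sum_eq_single m]
  · rw [hpow, PowerSeries.coeff_monomial_same]
  · intro q _ hq
    rw [hpow, PowerSeries.coeff_monomial, if_neg hq.symm, smul_zero]
  · simp

theorem logSeries_sub_mem_orderGE {R : Type*} [Ring R] [Algebra ℂ R] {Z W : PowerSeries R} {m : ℕ}
    (h : Z - W ∈ orderGE R m) : logSeries Z - logSeries W ∈ orderGE R m := fun i hi => by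
  rw [map_sub, logSeries, logSeries, PowerSeries.coeff_mk, PowerSeries.coeff_mk,
    ← Finset.sum_sub_distrib]
  refine Finset.sum_eq_zero fun q _ => ?_
  have h1 := add_pow_sub_pow_mem (X := W - 1) h q i hi
  rw [show W - 1 + (Z - W) = Z - 1 by abel, map_sub] at h1
  rw [← smul_sub, h1, smul_zero]

theorem eq_zero_of_eq_neg {R : Type*} [Ring R] [Algebra ℂ R] {x : R} (h : x = -x) : x = 0 := by
  have h1 : (2 : ℂ) • x = 0 := by
    rw [two_smul]
    nth_rewrite 1 [h]
    exact neg_add_cancel x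
  calc x = (2 : ℂ)⁻¹ • (2 : ℂ) • x := by rw [smul_smul]; norm_num
    _ = 0 := by rw [h1, smul_zero]

namespace BasicIntegrator

variable {n d : ℕ} {B : BasicIntegrator n d}

/-! ### Expansion of the exact solution -/

section Flow

variable {x : Fin d → ℂ} {y : ℝ → Fin d → ℂ}

theorem exists_solution (hx : x ∈ B.U) : ∃ y : ℝ → Fin d → ℂ, y 0 = x ∧
    ∀ᶠ t in 𝓝 (0 : ℝ), HasDerivAt y (B.f (y t)) t := by
  have h1 : ContDiffAt ℝ 1 B.f x := (B.analytic_f x hx).contDiffAt.restrict_scalars ℝ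
  obtain ⟨y, hy0, ε, hε, hy⟩ :=
    h1.exists_forall_mem_closedBall_exists_eq_forall_mem_Ioo_hasDerivAt₀ 0
  exact ⟨y, hy0, eventually_of_mem (Ioo_mem_nhds (by linarith) (by linarith)) hy⟩

theorem tendsto_solution (hy0 : y 0 = x)
    (hy : ∀ᶠ t in 𝓝 (0 : ℝ), HasDerivAt y (B.f (y t)) t) : Tendsto y (𝓝 0) (𝓝 x) := by
  have := hy.self_of_nhds.continuousAt.tendsto
  rwa [hy0] at this

theorem hasDerivAt_comp_solution (g : B.functions) {t : ℝ} (ht : y t ∈ B.U)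
    (hy : HasDerivAt y (B.f (y t)) t) :
    HasDerivAt (fun t => g.1 (y t)) (fderiv ℂ g.1 (y t) (B.f (y t))) t := by
  have h1 : HasFDerivAt g.1 ((fderiv ℂ g.1 (y t)).restrictScalars ℝ) (y t) :=
    (g.2.1 _ ht).differentiableAt.hasFDerivAt.restrictScalars ℝ
  exact h1.comp_hasDerivAt t hy

theorem isBigO_comp_sub_comp (g : B.functions) (hx : x ∈ B.U) {u v : ℝ → Fin d → ℂ}
    (hu : Tendsto u (𝓝 0) (𝓝 x)) (hv : Tendsto v (𝓝 0) (𝓝 x)) :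
    (fun h => g.1 (u h) - g.1 (v h)) =O[𝓝 0] fun h => u h - v h := by
  have h1 : ContDiffAt ℂ 1 g.1 x := (g.2.1 x hx).contDiffAt
  obtain ⟨K, s, hs, hK⟩ := h1.exists_lipschitzOnWith
  refine Asymptotics.IsBigO.of_bound K ?_
  filter_upwards [hu hs, hv hs] with h h2 h3
  simpa [dist_eq_norm] using hK.dist_le_mul _ h2 _ h3

theorem tendsto_S (hx : x ∈ B.U) : Tendsto (fun h : ℝ => B.S h x) (𝓝 0) (𝓝 x) := by
  have hlim : Tendsto (fun h : ℝ => ((h : ℂ), x)) (𝓝 0) (𝓝 (0, x)) := by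
    have hc : Continuous fun h : ℝ => ((h : ℂ), x) := by fun_prop
    simpa using hc.tendsto 0
  exact (represents_S.tendsto x hx).comp hlim

theorem isBigO_comp_S_sub_comp_solution (g : B.functions) (hx : x ∈ B.U) (hy0 : y 0 = x)
    (hy : ∀ᶠ t in 𝓝 (0 : ℝ), HasDerivAt y (B.f (y t)) t) :
    (fun h : ℝ => g.1 (B.S h x) - g.1 (y h)) =O[𝓝 0] fun h : ℝ => h ^ (2 * n + 1) :=
  (isBigO_comp_sub_comp g hx (tendsto_S hx) (tendsto_solution hy0 hy)).trans
    (B.order x hx y hy0 hy)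

/-- Order at least one makes `S_h(x)` tangent to the exact solution, so the first Taylor operator is
the Lie derivative along `f`. -/
theorem taylor_one_apply (hn : 1 ≤ n) (g : B.functions) (hx : x ∈ B.U) :
    (B.taylor 1 g).1 x = fderiv ℂ g.1 x (B.f x) := by
  obtain ⟨y, hy0, hy⟩ := exists_solution hx
  have h1 := hasDerivAt_comp_solution g (t := 0) (by rwa [hy0]) hy.self_of_nhds
  rw [hy0] at h1
  refine HasDerivAt.unique ?_ h1
  have h2 := (represents_S (B := B)).hasExpansion hx g 2
  have hpow : (fun h : ℝ => h ^ (2 * n + 1)) =O[𝓝 0] fun h : ℝ => h ^ 2 := by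
    rcases Nat.eq_or_lt_of_le (show 2 ≤ 2 * n + 1 by omega) with h | h
    · rw [← h]
    · exact (Asymptotics.isLittleO_pow_pow h).isBigO
  have h3 := h2.sub ((isBigO_comp_S_sub_comp_solution g hx hy0 hy).trans hpow)
  have hS0 : B.taylor 0 g = g := functions_ext fun z hz => by
    rw [taylor_apply _ _ hz]
    simp [B.S_zero z hz]
  rw [hasDerivAt_iff_isLittleO_nhds_zero]
  refine (h3.trans_isLittleO ?_).congr_left fun h => ?_
  · simpa using Asymptotics.isLittleO_pow_pow (𝕜 := ℝ) (m := 1) (n := 2) (by norm_num)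
  · simp only [Finset.sum_range_succ, Finset.sum_range_zero, PowerSeries.coeff_mk, hS0, zero_add,
      hy0, pow_zero, pow_one, one_mul, Complex.real_smul]
    ring

/-- Along a solution the derivative of `g` is `Y_1 g`, so the bound for `g` with `N + 1` terms is
the integrated bound for `Y_1 g` with `N` terms. The induction therefore runs over all `g` at once.
-/
theorem hasExpansion_solution (hn : 1 ≤ n) (hx : x ∈ B.U) (hy0 : y 0 = x)
    (hy : ∀ᶠ t in 𝓝 (0 : ℝ), HasDerivAt y (B.f (y t)) t) (g : B.functions) :
    HasExpansion (fun t => g.1 (y t)) fun m =>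
      (PowerSeries.coeff m (expSeries (linearSeries (B.taylor 1))) g).1 x := by
  intro N
  have hcoeff : ∀ (m : ℕ) (g : B.functions),
      (PowerSeries.coeff m (expSeries (linearSeries (B.taylor 1))) g).1 x =
        ((m.factorial : ℂ)⁻¹) * ((B.taylor 1 ^ m) g).1 x := fun m g => by
    exact congrArg (fun A : Module.End ℂ B.functions => (A g).1 x)
      (coeff_expSeries_linearSeries (B.taylor 1) m)
  simp only [hcoeff]
  induction N generalizing g with
  | zero =>
    refine ((functions_isBigO_one g hx (tendsto_solution hy0 hy)).trans
      (Asymptotics.isBigO_const_const _ (one_ne_zero (α := ℝ)) _)).congr (fun t => ?_) fun t => ?_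
    · rw [Finset.sum_range_zero, sub_zero]
    · rw [pow_zero]
  | succ N ih =>
    -- The integration lemma has a parameter; here it is a dummy real variable kept at `0`.
    have hlim : Tendsto (fun t : ℝ => (t, (0 : ℝ))) (𝓝 0) (𝓝 (0, 0)) := by
      have hc : Continuous fun t : ℝ => (t, (0 : ℝ)) := by fun_prop
      exact hc.tendsto 0
    have hfst : Tendsto (fun p : ℝ × ℝ => p.1) (𝓝 (0, 0)) (𝓝 0) :=
      continuous_fst.tendsto ((0 : ℝ), (0 : ℝ))
    refine (isBigO_pow_succ_of_hasDerivAt (𝕜 := ℝ) (x := (0 : ℝ)) (N := N)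
      (H := fun p => g.1 (y p.1) - ∑ m ∈ Finset.range (N + 1), (p.1 : ℂ) ^ m *
        (((m.factorial : ℂ)⁻¹) * ((B.taylor 1 ^ m) g).1 x))
      (H' := fun p => (B.taylor 1 g).1 (y p.1) - ∑ m ∈ Finset.range N, (p.1 : ℂ) ^ m *
        (((m.factorial : ℂ)⁻¹) * ((B.taylor 1 ^ m) (B.taylor 1 g)).1 x)) ?_ ?_
      ((ih (B.taylor 1 g)).comp_tendsto hfst)).comp_tendsto hlim
    · have hU : ∀ᶠ t in 𝓝 (0 : ℝ), y t ∈ B.U :=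
        (tendsto_solution hy0 hy).eventually (B.isOpen_U.mem_nhds hx)
      filter_upwards [hfst.eventually (hy.and hU)] with p hp
      have h1 := hasDerivAt_comp_solution g hp.2 hp.1
      rw [← taylor_one_apply hn g hp.2] at h1
      have h2 : ∀ m ∈ Finset.range N, HasDerivAt (fun h : ℝ => (h : ℂ) ^ (m + 1) *
          ((((m + 1).factorial : ℂ)⁻¹) * ((B.taylor 1 ^ (m + 1)) g).1 x))
          ((p.1 : ℂ) ^ m * (((m.factorial : ℂ)⁻¹) * ((B.taylor 1 ^ m) (B.taylor 1 g)).1 x))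
          p.1 := by
        intro m _
        refine (((hasDerivAt_pow (m + 1) (p.1 : ℂ)).comp_ofReal).mul_const _).congr_deriv ?_
        have h6 : ((m + 1 : ℕ) : ℂ) ≠ 0 := Nat.cast_ne_zero.2 (by omega)
        have h7 : (m.factorial : ℂ) ≠ 0 := Nat.cast_ne_zero.2 (Nat.factorial_ne_zero m)
        rw [pow_succ (B.taylor 1), Module.End.mul_apply, Nat.factorial_succ, Nat.cast_mul,
          Nat.add_sub_cancel]
        field_simp
      have h3 := h1.sub ((HasDerivAt.fun_sum h2).add_const
        ((p.1 : ℂ) ^ 0 * (((Nat.factorial 0 : ℂ)⁻¹) * ((B.taylor 1 ^ 0) g).1 x)))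
      refine h3.congr_of_eventuallyEq (Eventually.of_forall fun h => ?_)
      simp only [Finset.sum_range_succ', pow_zero]
      rfl
    · intro z
      simp [Finset.sum_range_succ', hy0]

end Flow

/-! ### The operator series of a basic integrator -/

section Operator

theorem taylor_sub_expSeries_mem (hn : 1 ≤ n) :
    PowerSeries.mk B.taylor - expSeries (linearSeries (B.taylor 1)) ∈
      orderGE (Module.End ℂ B.functions) (2 * n + 1) := by
  intro m hm
  refine LinearMap.ext fun g => functions_ext fun x hx => ?_
  obtain ⟨y, hy0, hy⟩ := exists_solution hx
  have h := ((represents_S.hasExpansion hx g).sub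
    (hasExpansion_solution hn hx hy0 hy g)).isBigO_iff (2 * n + 1) |>.1
    (isBigO_comp_S_sub_comp_solution g hx hy0 hy) m hm
  exact h

/-- `S_h ∘ S_(-h) = id` read on expansions; uniqueness of the coefficients makes it an identity of
operators. -/
theorem dilate_taylor_mul_taylor :
    dilate (-1) (PowerSeries.mk B.taylor) * PowerSeries.mk B.taylor = 1 := by
  ext m : 1
  refine LinearMap.ext fun g => functions_ext fun x hx => ?_
  have h1 := ((represents_S (B := B)).comp (represents_S.dilate (-1))).hasExpansion hx g
  have h2 := (represents_one (B := B)).hasExpansion hx g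
  refine HasExpansion.unique h1 (h2.congr ?_) m
  have h3 : Tendsto (fun h : ℝ => (h : ℂ)) (𝓝 0) (𝓝 0) := by
    simpa using Complex.continuous_ofReal.tendsto 0
  filter_upwards [h3.eventually (B.symmetric x hx)] with h hh
  simp [hh]

theorem taylor_zero : B.taylor 0 = 1 :=
  LinearMap.ext fun g => functions_ext fun z hz => by
    rw [taylor_apply _ _ hz]
    simp [B.S_zero z hz]

theorem expSeries_operatorSeries : expSeries B.operatorSeries = PowerSeries.mk B.taylor :=
  expSeries_logSeries (by rw [PowerSeries.coeff_mk, taylor_zero])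

theorem operatorSeries_sub_mem (hn : 1 ≤ n) :
    B.operatorSeries - linearSeries (B.taylor 1) ∈
      orderGE (Module.End ℂ B.functions) (2 * n + 1) := by
  have h := logSeries_sub_mem_orderGE (taylor_sub_expSeries_mem (B := B) hn)
  rwa [logSeries_expSeries (linearSeries_mem _)] at h

theorem coeff_operatorSeries_even {m : ℕ} (hm : Even m) :
    PowerSeries.coeff m B.operatorSeries = 0 := by
  have h := logSeries_eq_neg (Z := PowerSeries.mk B.taylor)
    (by rw [PowerSeries.coeff_mk, taylor_zero]) dilate_taylor_mul_taylor
  rw [← dilate_logSeries] at h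
  have h1 := congrArg (PowerSeries.coeff m) h
  rw [coeff_dilate (R := Module.End ℂ B.functions), hm.neg_one_pow, one_smul, map_neg] at h1
  exact eq_zero_of_eq_neg (R := Module.End ℂ B.functions) h1

theorem toOperator_Y (m : ℕ) : B.toOperator (Y m) = PowerSeries.coeff m B.operatorSeries := by
  simp [toOperator, Y]

/-- The order of the integrator removes every degree below `2n+1` except `1`, and symmetry removes
the even ones. What remains is the pattern of `basicSeries`, so formal identities transfer to
operators. -/
theorem map_toOperator_basicSeries (hn : 1 ≤ n) :
    PowerSeries.map (B.toOperator : Words →+* Module.End ℂ B.functions) (basicSeries n) =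
      B.operatorSeries := by
  ext m : 1
  rw [PowerSeries.coeff_map, coeff_basicSeries]
  split_ifs with h
  · exact toOperator_Y m
  · rw [map_zero]
    rw [not_or, not_and_or, not_le, Nat.not_odd_iff_even] at h
    rcases h with ⟨h1, h2 | h2⟩
    · have h3 := operatorSeries_sub_mem (B := B) hn m h2
      rw [map_sub, coeff_linearSeries, if_neg h1] at h3
      exact (sub_eq_zero.1 h3).symm
    · exact (coeff_operatorSeries_even h2).symm

theorem toOperator_Y_one (hn : 1 ≤ n) : B.toOperator (Y 1) = B.taylor 1 := by
  have h := operatorSeries_sub_mem (B := B) hn 1 (by omega)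
  rw [map_sub, coeff_linearSeries, if_pos rfl, sub_eq_zero] at h
  rw [toOperator_Y, h]

theorem map_toOperator_expSeries (X : PowerSeries Words) :
    PowerSeries.map (B.toOperator : Words →+* Module.End ℂ B.functions) (expSeries X) =
      expSeries (PowerSeries.map (B.toOperator : Words →+* Module.End ℂ B.functions) X) :=
  map_algHom_expSeries (R' := Module.End ℂ B.functions) B.toOperator X

theorem map_toOperator_dilate (a : ℂ) (X : PowerSeries Words) :
    PowerSeries.map (B.toOperator : Words →+* Module.End ℂ B.functions) (dilate a X) =
      dilate a (PowerSeries.map (B.toOperator : Words →+* Module.End ℂ B.functions) X) :=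
  map_algHom_dilate (R' := Module.End ℂ B.functions) B.toOperator a X

theorem represents_composition (hn : 1 ≤ n) (α : List ℂ) :
    B.Represents (PowerSeries.map (B.toOperator : Words →+* Module.End ℂ B.functions)
      (compSeries n α)) (composition B.S α) := by
  induction α with
  | nil =>
    have h : compSeries n [] = 1 := by simp [compSeries]
    rw [h, map_one]
    exact represents_one
  | cons a α ih =>
    rw [compSeries_cons, map_mul, map_toOperator_expSeries, map_toOperator_dilate,
      map_toOperator_basicSeries hn, ← dilate_expSeries, expSeries_operatorSeries]
    exact (represents_S.dilate a).comp ih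

theorem map_toOperator_expSeries_linearSeries (hn : 1 ≤ n) :
    PowerSeries.map (B.toOperator : Words →+* Module.End ℂ B.functions)
      (expSeries (linearSeries (Y 1))) = expSeries (linearSeries (B.taylor 1)) := by
  rw [map_toOperator_expSeries]
  congr 1
  ext m : 1
  have h : PowerSeries.coeff m (linearSeries (B.taylor 1)) = if m = 1 then B.taylor 1 else 0 :=
    coeff_linearSeries _ _
  rw [PowerSeries.coeff_map, coeff_linearSeries, h]
  split_ifs
  · exact toOperator_Y_one hn
  · exact map_zero _

theorem coord_apply (i : Fin d) {x : Fin d → ℂ} (hx : x ∈ B.U) : (B.coord i).1 x = x i := by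
  simp [coord, hx]

theorem hasExpansion_composition (hn : 1 ≤ n) (α : List ℂ) {x : Fin d → ℂ} (hx : x ∈ B.U)
    (i : Fin d) : HasExpansion (fun h => composition B.S α h x i) fun m =>
      (B.toOperator (PowerSeries.coeff m (compSeries n α)) (B.coord i)).1 x := by
  have h := represents_composition (B := B) hn α
  refine (h.hasExpansion hx (B.coord i)).congr ?_
  have hlim : Tendsto (fun h : ℝ => ((h : ℂ), x)) (𝓝 0) (𝓝 (0, x)) := by
    have hc : Continuous fun h : ℝ => ((h : ℂ), x) := by fun_prop
    simpa using hc.tendsto 0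
  filter_upwards [((h.tendsto x hx).comp hlim).eventually (B.isOpen_U.mem_nhds hx)] with t ht
  exact coord_apply i ht

theorem hasExpansion_solution_apply (hn : 1 ≤ n) {x : Fin d → ℂ} (hx : x ∈ B.U)
    {y : ℝ → Fin d → ℂ} (hy0 : y 0 = x)
    (hy : ∀ᶠ t in 𝓝 (0 : ℝ), HasDerivAt y (B.f (y t)) t) (i : Fin d) :
    HasExpansion (fun h => y h i) fun m =>
      (B.toOperator (PowerSeries.coeff m (expSeries (linearSeries (Y 1)))) (B.coord i)).1 x := by
  have h := hasExpansion_solution hn hx hy0 hy (B.coord i)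
  rw [← map_toOperator_expSeries_linearSeries hn] at h
  refine h.congr ?_
  filter_upwards [(tendsto_solution hy0 hy).eventually (B.isOpen_U.mem_nhds hx)] with t ht
  exact coord_apply i ht

theorem hasExpansion_linComb_sub (hn : 1 ≤ n) {k : ℕ} (hk : 1 ≤ k) (α : Fin k → List ℂ)
    {x : Fin d → ℂ} (hx : x ∈ B.U) {y : ℝ → Fin d → ℂ} (hy0 : y 0 = x)
    (hy : ∀ᶠ t in 𝓝 (0 : ℝ), HasDerivAt y (B.f (y t)) t) (i : Fin d) :
    HasExpansion (fun h => (linComb B.S α h x - y h) i) fun m => (1 : ℂ) / (2 * k) *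
      (B.toOperator (PowerSeries.coeff m (defect n α)) (B.coord i)).1 x := by
  have hs := hasExpansion_solution_apply hn hx hy0 hy i
  have h := (HasExpansion.sum (I := Finset.univ) fun (j : Fin k) _ =>
    ((hasExpansion_composition (B := B) hn (α j) hx i).add
      (hasExpansion_composition (B := B) hn ((α j).map star) hx i)).sub
        (hs.const_mul 2)).const_mul ((1 : ℂ) / (2 * k))
  have hk0 : (k : ℂ) ≠ 0 := Nat.cast_ne_zero.2 (by omega)
  convert h using 1
  · funext t
    simp only [linComb, Pi.sub_apply, Pi.smul_apply, Finset.sum_apply, Pi.add_apply, smul_eq_mul,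
      Finset.sum_sub_distrib, Finset.sum_const, Finset.card_univ, Fintype.card_fin, nsmul_eq_mul]
    field_simp
  · funext m
    congr 1
    simp only [defect, map_sum, map_sub, map_add, coeff_complex_smul, map_smul,
      LinearMap.sum_apply, LinearMap.sub_apply, LinearMap.add_apply, LinearMap.smul_apply,
      Submodule.coe_sum, Finset.sum_apply]
    rfl

/-- The linear combination has order `r` if and only if the coefficients of its defect vanish on
the coordinate functions up to degree `r`. -/
theorem hasOrder_linComb_iff (hn : 1 ≤ n) {k : ℕ} (hk : 1 ≤ k) (α : Fin k → List ℂ)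
    {K : Set (Fin d → ℂ)} (hK : K ⊆ B.U) (r : ℕ) :
    HasOrder B.f K (linComb B.S α) r ↔ ∀ m ≤ r, B.components K
      (PowerSeries.coeff m (defect n α)) = 0 := by
  have hk0 : (1 : ℂ) / (2 * k) ≠ 0 :=
    one_div_ne_zero (mul_ne_zero two_ne_zero (Nat.cast_ne_zero.2 (by omega)))
  constructor
  · intro h m hm
    funext i x
    obtain ⟨y, hy0, hy⟩ := exists_solution (hK x.2)
    have h1 := Asymptotics.isBigO_pi.1 (h x x.2 y hy0 hy) i
    have h2 := (hasExpansion_linComb_sub hn hk α (hK x.2) hy0 hy i).isBigO_iff (r + 1) |>.1 h1 m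
      (by omega)
    exact (mul_eq_zero.1 h2).resolve_left hk0
  · intro h x hx y hy0 hy
    refine Asymptotics.isBigO_pi.2 fun i => ?_
    refine (hasExpansion_linComb_sub hn hk α (hK hx) hy0 hy i).isBigO_iff (r + 1) |>.2
      fun m hm => ?_
    have h1 := congrFun (congrFun (h m (by omega)) i) ⟨x, hx⟩
    exact mul_eq_zero_of_right _ h1

end Operator

end BasicIntegrator

/-! ### Order conditions -/

section OrderConditions

variable {n k : ℕ} {α : Fin k → List ℂ} {μ : Fin k → ℕ → ℕ → ℝ}

theorem sum_logDefect_mem (hn : 1 ≤ n) (hα : ∀ j, IsConsistentSymConj (α j)) :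
    ∑ i, logDefect n α i ∈ orderGE Words (2 * n + 1) :=
  Submodule.sum_mem _ fun i _ => logDefect_mem hn hα i

/-- The even coefficient vanishes for free, so each odd condition gains two degrees. -/
theorem sum_logDefect_mem_add_two (hα : ∀ j, IsConsistentSymConj (α j)) {m : ℕ} (hm : Odd m)
    (h : ∑ i, logDefect n α i ∈ orderGE Words m)
    (h0 : PowerSeries.coeff m (∑ i, logDefect n α i) = 0) :
    ∑ i, logDefect n α i ∈ orderGE Words (m + 2) := by
  intro i hi
  rcases lt_or_ge i m with h1 | h1
  · exact h i h1
  · obtain rfl | rfl : i = m ∨ i = m + 1 := by omega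
    · exact h0
    · exact coeff_sum_logDefect_even hα hm.add_one

theorem sum_logDefect_mem_three (hn : 1 ≤ n) (hα : ∀ j, IsConsistentSymConj (α j))
    (hμ : ∀ j, IsBracketExpansion n (α j) (μ j)) (h1 : c μ (2 * n + 1) 1 = 0) :
    ∑ i, logDefect n α i ∈ orderGE Words (2 * n + 3) :=
  sum_logDefect_mem_add_two hα ⟨n, rfl⟩ (sum_logDefect_mem hn hα) (by
    rw [coeff_sum_logDefect_one hn hα hμ, h1]
    simp)

theorem sum_logDefect_mem_five (hn : 1 ≤ n) (hα : ∀ j, IsConsistentSymConj (α j))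
    (hμ : ∀ j, IsBracketExpansion n (α j) (μ j)) (h1 : c μ (2 * n + 1) 1 = 0)
    (h3 : c μ (2 * n + 3) 1 = 0) (h3' : c μ (2 * n + 3) 2 = 0) :
    ∑ i, logDefect n α i ∈ orderGE Words (2 * n + 5) :=
  sum_logDefect_mem_add_two hα ⟨n + 1, by ring⟩ (sum_logDefect_mem_three hn hα hμ h1) (by
    rw [coeff_sum_logDefect_three hα hμ, h3, h3']
    simp)

theorem sum_logDefect_mem_seven (hn : 2 ≤ n) (hα : ∀ j, IsConsistentSymConj (α j))
    (hμ : ∀ j, IsBracketExpansion n (α j) (μ j)) (h1 : c μ (2 * n + 1) 1 = 0)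
    (h3 : c μ (2 * n + 3) 1 = 0) (h3' : c μ (2 * n + 3) 2 = 0) (h5 : c μ (2 * n + 5) 1 = 0)
    (h5' : c μ (2 * n + 5) 2 = 0) (h5'' : c μ (2 * n + 5) 3 = 0) :
    ∑ i, logDefect n α i ∈ orderGE Words (2 * n + 7) :=
  sum_logDefect_mem_add_two hα ⟨n + 2, by ring⟩
    (sum_logDefect_mem_five (by omega) hα hμ h1 h3 h3') (by
      rw [coeff_sum_logDefect_five hn hα hμ, h5, h5', h5'']
      simp)

/-- For `r ≤ 4n+1` the generic order `s = 2n+1` of the deviations is enough. If the `μ_(2n+1,1)` all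
agree, their sum is `k` times each, so each vanishes and `s = 2n+2` allows `r + 1 ≤ 4n+4`. -/
theorem defect_mem_of_inRange (hn : 1 ≤ n) (hα : ∀ j, IsConsistentSymConj (α j))
    (hμ : ∀ j, IsBracketExpansion n (α j) (μ j)) (h1 : c μ (2 * n + 1) 1 = 0) {r : ℕ}
    (hr : InRange n μ r) (h : ∑ i, logDefect n α i ∈ orderGE Words (r + 1)) :
    defect n α ∈ orderGE Words (r + 1) := by
  rcases hr with hr | ⟨hr, hc⟩
  · exact defect_mem_of_sum_mem (logDefect_mem hn hα) h (by omega)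
  · have h0 : ∀ j, μ j (2 * n + 1) 1 = 0 := fun j => by
      have h2 : c μ (2 * n + 1) 1 = k * μ j (2 * n + 1) 1 := by
        rw [c, Finset.sum_congr rfl fun i _ => hc i j]
        simp
      have hk : (k : ℝ) ≠ 0 := Nat.cast_ne_zero.2 (by have := j.2; omega)
      exact (mul_eq_zero.1 (h2.symm.trans h1)).resolve_left hk
    refine defect_mem_of_sum_mem (logDefect_mem_of_coeff_eq_zero hn hα fun j => ?_) h (by omega)
    rw [(hμ j).deg_one, h0]
    simp

variable {d : ℕ} {B : BasicIntegrator n d} {K : Set (Fin d → ℂ)}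

theorem BasicIntegrator.components_add (v w : Words) :
    B.components K (v + w) = B.components K v + B.components K w := by
  funext i x
  simp [components]

theorem BasicIntegrator.components_smul (z : ℂ) (w : Words) :
    B.components K (z • w) = z • B.components K w := by
  funext i x
  simp [components]

theorem BasicIntegrator.components_zero : B.components K 0 = 0 := by
  funext i x
  simp [components]

theorem BasicIntegrator.components_sum {ι : Type*} (I : Finset ι) (w : ι → Words) :
    B.components K (∑ l ∈ I, w l) = ∑ l ∈ I, B.components K (w l) :=
  map_sum (AddMonoidHom.mk' (B.components K) components_add) w I

theorem hasOrder_of_defect_mem (hn : 1 ≤ n) (hk : 1 ≤ k) (hK : K ⊆ B.U) {r : ℕ}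
    (h : defect n α ∈ orderGE Words (r + 1)) : HasOrder B.f K (linComb B.S α) r := by
  rw [BasicIntegrator.hasOrder_linComb_iff hn hk α hK]
  intro m hm
  rw [h m (by omega), BasicIntegrator.components_zero]

theorem coeff_eq_zero_of_independent {q p : ℕ} (hB : B.Independent q K) (hp1 : 1 ≤ p)
    (hpq : p ≤ q) (a : Fin p → ℝ)
    (h : B.components K ((2 : ℂ) • ∑ l, (a l : ℂ) • E (2 * n + 2 * p - 1) (l + 1)) = 0)
    (l : Fin p) : a l = 0 := by
  refine Fintype.linearIndependent_iff.1 (hB p hp1 hpq) a ?_ l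
  rw [BasicIntegrator.components_smul, smul_eq_zero, BasicIntegrator.components_sum] at h
  rw [← h.resolve_left two_ne_zero]
  refine Finset.sum_congr rfl fun l _ => ?_
  rw [BasicIntegrator.components_smul]
  funext i x
  simp

variable (hn : 1 ≤ n) (hk : 1 ≤ k) (hα : ∀ j, IsConsistentSymConj (α j))
  (hμ : ∀ j, IsBracketExpansion n (α j) (μ j)) (hK : K ⊆ B.U)
include hn hk hα hK

/-- Only the degree `m` has to stay at most `4n+1`, while `r` is free. This is why necessity
persists outside the range of sufficiency. -/
theorem components_coeff_sum_eq_zero {r m : ℕ} (h : HasOrder B.f K (linComb B.S α) r)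
    (hmr : m ≤ r) (hm : m ≤ 4 * n + 1) (h1 : 1 ≤ m)
    (hs : ∑ i, logDefect n α i ∈ orderGE Words m) :
    B.components K (PowerSeries.coeff m (∑ i, logDefect n α i)) = 0 := by
  rw [← coeff_defect_eq hn hα hm h1 hs]
  exact (BasicIntegrator.hasOrder_linComb_iff hn hk α hK r).1 h m hmr

include hμ

theorem condition_one_of_hasOrder {q r : ℕ} (hB : B.Independent q K) (hq : 1 ≤ q)
    (hr : 2 * n + 1 ≤ r) (h : HasOrder B.f K (linComb B.S α) r) : c μ (2 * n + 1) 1 = 0 := by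
  have h1 := components_coeff_sum_eq_zero hn hk hα hK h hr (by omega) (by omega)
    (sum_logDefect_mem hn hα)
  rw [coeff_sum_logDefect_one hn hα hμ] at h1
  exact coeff_eq_zero_of_independent hB le_rfl hq (fun _ => c μ (2 * n + 1) 1)
    (by simpa using h1) 0

theorem condition_three_of_hasOrder {q r : ℕ} (hB : B.Independent q K) (hq : 2 ≤ q)
    (hr : 2 * n + 3 ≤ r) (h : HasOrder B.f K (linComb B.S α) r) :
    c μ (2 * n + 3) 1 = 0 ∧ c μ (2 * n + 3) 2 = 0 := by
  have h0 := condition_one_of_hasOrder hn hk hα hμ hK hB (by omega) (by omega) h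
  have h1 := components_coeff_sum_eq_zero hn hk hα hK h hr (by omega) (by omega)
    (sum_logDefect_mem_three hn hα hμ h0)
  rw [coeff_sum_logDefect_three hα hμ] at h1
  have h2 := coeff_eq_zero_of_independent hB (by omega) hq
    ![c μ (2 * n + 3) 1, c μ (2 * n + 3) 2] (by simpa [Fin.sum_univ_two] using h1)
  exact ⟨h2 0, h2 1⟩

theorem condition_five_of_hasOrder {q r : ℕ} (hn2 : 2 ≤ n) (hB : B.Independent q K) (hq : 3 ≤ q)
    (hr : 2 * n + 5 ≤ r) (h : HasOrder B.f K (linComb B.S α) r) :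
    c μ (2 * n + 5) 1 = 0 ∧ c μ (2 * n + 5) 2 = 0 ∧ c μ (2 * n + 5) 3 = 0 := by
  have h0 := condition_one_of_hasOrder hn hk hα hμ hK hB (by omega) (by omega) h
  have h3 := condition_three_of_hasOrder hn hk hα hμ hK hB (by omega) (by omega) h
  have h1 := components_coeff_sum_eq_zero hn hk hα hK h hr (by omega) (by omega)
    (sum_logDefect_mem_five hn hα hμ h0 h3.1 h3.2)
  rw [coeff_sum_logDefect_five hn2 hα hμ] at h1
  have h2 := coeff_eq_zero_of_independent hB (by omega) hq
    ![c μ (2 * n + 5) 1, c μ (2 * n + 5) 2, c μ (2 * n + 5) 3]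
    (by simpa [Fin.sum_univ_three] using h1)
  exact ⟨h2 0, h2 1, h2 2⟩

end OrderConditions

/-! ### Expansions given by formal power series -/

theorem hasExpansion_exp :
    HasExpansion (fun h => Complex.exp h) fun m => PowerSeries.coeff m (PowerSeries.exp ℂ) := by
  intro N
  have h : Tendsto (fun h : ℝ => (h : ℂ)) (𝓝 0) (𝓝 0) := by
    simpa using Complex.continuous_ofReal.tendsto 0
  refine (((Complex.exp_sub_sum_range_isBigO_pow N).comp_tendsto h).congr_left fun t => ?_).trans
    (Asymptotics.IsBigO.of_bound 1 (Eventually.of_forall fun t => by simp))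
  simp only [Function.comp_apply, PowerSeries.coeff_exp]
  congr 1
  exact Finset.sum_congr rfl fun m _ => by simp [div_eq_mul_inv]

theorem hasExpansion_const (z : ℂ) :
    HasExpansion (fun _ => z) fun m => PowerSeries.coeff m (PowerSeries.C z) := by
  intro N
  cases N with
  | zero => simpa using Asymptotics.isBigO_const_const z (one_ne_zero (α := ℝ)) _
  | succ N =>
    refine (Asymptotics.isBigO_zero _ _).congr_left fun t => ?_
    simp [PowerSeries.coeff_C]

theorem HasExpansion.mul_X {u : ℝ → ℂ} {F : PowerSeries ℂ}
    (hu : HasExpansion u fun m => PowerSeries.coeff m F) :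
    HasExpansion (fun h => u h * h) fun m => PowerSeries.coeff m (F * PowerSeries.X) := by
  have hid : (fun h : ℝ => (h : ℂ)) =O[𝓝 0] fun h : ℝ => h :=
    Asymptotics.IsBigO.of_bound 1 (Eventually.of_forall fun t => by simp)
  have h1 : (fun h : ℝ => h) =O[𝓝 0] fun _ : ℝ => (1 : ℝ) := tendsto_id.isBigO_one ℝ
  intro N
  cases N with
  | zero =>
    have := (hu 0).mul (hid.trans h1)
    simpa using this
  | succ N =>
    refine ((hu N).mul hid).congr (fun t => ?_) fun t => (pow_succ t N).symm
    rw [Finset.sum_range_succ']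
    simp only [PowerSeries.coeff_succ_mul_X, PowerSeries.coeff_zero_mul_X, mul_zero, add_zero,
      sub_mul, Finset.sum_mul]
    congr 1
    exact Finset.sum_congr rfl fun m _ => by ring

theorem HasExpansion.mul_X_pow {u : ℝ → ℂ} {F : PowerSeries ℂ}
    (hu : HasExpansion u fun m => PowerSeries.coeff m F) (N : ℕ) :
    HasExpansion (fun h => u h * (h : ℂ) ^ N)
      fun m => PowerSeries.coeff m (F * PowerSeries.X ^ N) := by
  induction N with
  | zero => simpa using hu
  | succ N ih => simpa only [pow_succ, mul_assoc] using ih.mul_X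

/-! ### Intertwining of exponentials and logarithms -/

section Intertwining

variable {R : Type*} [Ring R] [Algebra ℂ R]

/-- Clear for polynomials; truncation carries it over to power series. -/
theorem SemiconjBy.evalSeries {U X X' : PowerSeries R} (hX : X ∈ orderGE R 1)
    (hX' : X' ∈ orderGE R 1) (h : SemiconjBy U X X') (p : PowerSeries ℂ) :
    SemiconjBy U (evalSeries X p) (evalSeries X' p) := by
  refine eq_of_sub_mem_orderGE fun M => ?_
  have h1 := mul_mem_orderGE_left U (evalSeries_sub_aeval_mem hX M p)
  have h2 := mul_mem_orderGE_right U (evalSeries_sub_aeval_mem hX' M p)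
  have h3 : U * Polynomial.aeval X (PowerSeries.trunc M p) =
      Polynomial.aeval X' (PowerSeries.trunc M p) * U := by
    rw [Polynomial.aeval_eq_sum_range, Polynomial.aeval_eq_sum_range, Finset.mul_sum,
      Finset.sum_mul]
    refine Finset.sum_congr rfl fun q _ => ?_
    rw [mul_smul_comm, smul_mul_assoc, (h.pow_right q).eq]
  rw [mul_sub, h3] at h1
  rw [sub_mul] at h2
  simpa using sub_mem h1 h2

theorem SemiconjBy.logSeries {U Z Z' : PowerSeries R} (hZ : PowerSeries.coeff 0 Z = 1)
    (hZ' : PowerSeries.coeff 0 Z' = 1) (h : SemiconjBy U Z Z') :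
    SemiconjBy U (logSeries Z) (logSeries Z') := by
  rw [logSeries_eq_evalSeries, logSeries_eq_evalSeries]
  refine SemiconjBy.evalSeries
    (mem_orderGE_one.2 (by rw [map_sub, hZ, PowerSeries.coeff_zero_one, sub_self]))
    (mem_orderGE_one.2 (by rw [map_sub, hZ', PowerSeries.coeff_zero_one, sub_self])) (h.sub_right (SemiconjBy.one_right U)) _

end Intertwining

/-! ### Logarithms of series with a known action on two elements -/

section LogAction

variable {R : Type*} [Ring R] [Algebra ℂ R]

theorem logSeries_one : logSeries (1 : PowerSeries R) = 0 := by
  rw [← expSeries_zero, logSeries_expSeries (zero_mem _)]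

theorem expSeries_linearSeries_one :
    expSeries (linearSeries (1 : R)) = PowerSeries.map (algebraMap ℂ R) (PowerSeries.exp ℂ) := by
  ext m
  rw [coeff_expSeries_linearSeries, PowerSeries.coeff_map, one_pow, Algebra.smul_def, mul_one]
  simp [PowerSeries.coeff_exp]

omit [Algebra ℂ R] in
theorem linearSeries_one : linearSeries (1 : R) = PowerSeries.X := by
  ext m
  rw [coeff_linearSeries, PowerSeries.coeff_X]

theorem coeff_C_mul_map (a : R) (p : PowerSeries ℂ) (m : ℕ) :
    PowerSeries.coeff m (PowerSeries.C a * PowerSeries.map (algebraMap ℂ R) p) =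
      PowerSeries.coeff m p • a := by
  rw [PowerSeries.coeff_C_mul, PowerSeries.coeff_map, ← Algebra.commutes, ← Algebra.smul_def]

theorem coeff_logSeries_mul_eq_zero {T : PowerSeries R} (hT : PowerSeries.coeff 0 T = 1) {b : R}
    (hb : ∀ m, PowerSeries.coeff m T * b = PowerSeries.coeff m (1 : PowerSeries ℂ) • b) :
    logSeries T * PowerSeries.C b = 0 := by
  have h : SemiconjBy (PowerSeries.C b) 1 T := by
    have h1 : T * PowerSeries.C b = PowerSeries.C b * 1 := by
      ext m
      rw [PowerSeries.coeff_mul_C, hb, ← coeff_C_mul_map, map_one]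
    exact h1.symm
  have h2 := SemiconjBy.logSeries PowerSeries.coeff_zero_one hT h
  rw [← h2.eq, logSeries_one, mul_zero]

/-- The action of `log T` on `a`, if `T` acts on `b` trivially and by `e^h` on `a + h^N b`. -/
theorem coeff_logSeries_mul {T : PowerSeries R} (hT : PowerSeries.coeff 0 T = 1) {a b : R} {N : ℕ}
    (ha : ∀ m, PowerSeries.coeff m T * a = PowerSeries.coeff m (PowerSeries.exp ℂ) • a +
      PowerSeries.coeff m ((PowerSeries.exp ℂ - 1) * PowerSeries.X ^ N) • b)
    (hb : ∀ m, PowerSeries.coeff m T * b = PowerSeries.coeff m (1 : PowerSeries ℂ) • b) (m : ℕ) :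
    PowerSeries.coeff m (logSeries T) * a =
      (if m = 1 then a else 0) + if m = N + 1 then b else 0 := by
  -- On `a + h^N b` the series `T` acts as the scalar `e^h`, so `log T` acts there as `h`. As `log
  -- T` kills `b`, it sends `a` to `h a + h^(N+1) b`.
  set U : PowerSeries R := PowerSeries.C a + PowerSeries.C b * PowerSeries.X ^ N with hU
  have hTa : T * PowerSeries.C a =
      PowerSeries.C a * PowerSeries.map (algebraMap ℂ R) (PowerSeries.exp ℂ) + PowerSeries.C b *
        PowerSeries.map (algebraMap ℂ R) ((PowerSeries.exp ℂ - 1) * PowerSeries.X ^ N) := by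
    ext m
    rw [PowerSeries.coeff_mul_C, ha, map_add, coeff_C_mul_map, coeff_C_mul_map]
  have hTb : T * PowerSeries.C b = PowerSeries.C b := by
    ext m
    rw [PowerSeries.coeff_mul_C, hb, ← coeff_C_mul_map, map_one, mul_one]
  have h : SemiconjBy U (expSeries (linearSeries 1)) T := by
    have h1 : T * U = U * expSeries (linearSeries 1) := by
      rw [hU, mul_add, ← mul_assoc, hTb, hTa, expSeries_linearSeries_one, map_mul, map_sub, map_one,
        map_pow, PowerSeries.map_X, add_mul, mul_assoc (PowerSeries.C b), PowerSeries.X_pow_mul]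
      noncomm_ring
    exact h1.symm
  have h2 := (SemiconjBy.logSeries (coeff_zero_expSeries _) hT h).eq
  rw [logSeries_expSeries (linearSeries_mem _), linearSeries_one, hU, mul_add, ← mul_assoc,
    coeff_logSeries_mul_eq_zero hT hb, zero_mul, add_zero, add_mul, mul_assoc, ← pow_succ] at h2
  have h3 := congrArg (PowerSeries.coeff m) h2
  rw [PowerSeries.coeff_mul_C, map_add, PowerSeries.coeff_C_mul, PowerSeries.coeff_C_mul,
    PowerSeries.coeff_X, PowerSeries.coeff_X_pow, mul_ite, mul_ite, mul_one, mul_zero, mul_one,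
    mul_zero] at h3
  exact h3.symm

end LogAction

/-! ### Vectors treated as rank one operators -/

section RankOne

variable {V : Type*} [AddCommGroup V] [Module ℂ V] (χ : V →ₗ[ℂ] ℂ)

/-- The rank one operator `g ↦ χ(g) v`. -/
def rankOne (v : V) : Module.End ℂ V := χ.smulRight v

theorem rankOne_apply (v g : V) : rankOne χ v g = χ g • v := rfl

theorem rankOne_add (v w : V) : rankOne χ (v + w) = rankOne χ v + rankOne χ w :=
  LinearMap.ext fun g => smul_add (χ g) v w

theorem rankOne_smul (z : ℂ) (v : V) : rankOne χ (z • v) = z • rankOne χ v :=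
  LinearMap.ext fun g => smul_comm (χ g) z v

/-- Makes the action on a vector a left multiplication in the endomorphism ring, so that the
intertwining results for rings apply; evaluating at a vector with `χ v = 1` recovers the vector. -/
theorem mul_rankOne (A : Module.End ℂ V) (v : V) : A * rankOne χ v = rankOne χ (A v) :=
  LinearMap.ext fun g => map_smul A (χ g) v

variable (T : PowerSeries (Module.End ℂ V)) (hT : PowerSeries.coeff 0 T = 1) {u v : V}
  (hχ : χ v = 1)
  (hv : ∀ m, PowerSeries.coeff m T v = PowerSeries.coeff m (1 : PowerSeries ℂ) • v)
include hT hχ hv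

theorem coeff_logSeries_apply_eq_zero (m : ℕ) : PowerSeries.coeff m (logSeries T) v = 0 := by
  have hb : ∀ m, PowerSeries.coeff m T * rankOne χ v =
      PowerSeries.coeff m (1 : PowerSeries ℂ) • rankOne χ v := fun m => by
    rw [mul_rankOne, hv, rankOne_smul]
  have h := congrArg (PowerSeries.coeff m) (coeff_logSeries_mul_eq_zero hT hb)
  rw [PowerSeries.coeff_mul_C, mul_rankOne, map_zero] at h
  simpa [rankOne_apply, hχ] using LinearMap.congr_fun h v

theorem coeff_logSeries_apply {N : ℕ}
    (hu : ∀ m, PowerSeries.coeff m T u = PowerSeries.coeff m (PowerSeries.exp ℂ) • u +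
      PowerSeries.coeff m ((PowerSeries.exp ℂ - 1) * PowerSeries.X ^ N) • v) (m : ℕ) :
    PowerSeries.coeff m (logSeries T) u =
      (if m = 1 then u else 0) + if m = N + 1 then v else 0 := by
  have hb : ∀ m, PowerSeries.coeff m T * rankOne χ v =
      PowerSeries.coeff m (1 : PowerSeries ℂ) • rankOne χ v := fun m => by
    rw [mul_rankOne, hv, rankOne_smul]
  have ha : ∀ m, PowerSeries.coeff m T * rankOne χ u =
      PowerSeries.coeff m (PowerSeries.exp ℂ) • rankOne χ u +
        PowerSeries.coeff m ((PowerSeries.exp ℂ - 1) * PowerSeries.X ^ N) • rankOne χ v :=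
    fun m => by rw [mul_rankOne, hu, rankOne_add, rankOne_smul, rankOne_smul]
  have h := coeff_logSeries_mul hT ha hb m
  rw [mul_rankOne] at h
  have h1 := LinearMap.congr_fun h v
  rw [rankOne_apply, hχ, one_smul, LinearMap.add_apply] at h1
  rw [h1]
  congr 1 <;> split_ifs <;> simp [rankOne_apply, hχ]

end RankOne

/-! ### An integrator with independent brackets -/

section Example

/-- The components of `e^(-t) y(t)` have zero derivative. -/
theorem solution_eq_exp {d : ℕ} {x : Fin d → ℂ} {y : ℝ → Fin d → ℂ} (hy0 : y 0 = x)
    (hy : ∀ᶠ t in 𝓝 (0 : ℝ), HasDerivAt y (y t) t) :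
    ∀ᶠ t in 𝓝 (0 : ℝ), y t = fun i => Complex.exp t * x i := by
  obtain ⟨ε, hε, hball⟩ := Metric.eventually_nhds_iff_ball.1 hy
  filter_upwards [Metric.ball_mem_nhds (0 : ℝ) hε] with t ht
  have hexp : ∀ s : ℝ, HasDerivAt (fun s : ℝ => Complex.exp (-s)) (-Complex.exp (-s)) s := fun s => by
    have h := (Complex.hasDerivAt_exp (-(s : ℂ))).comp (s : ℂ) (hasDerivAt_neg (s : ℂ))
    simpa using h.comp_ofReal
  funext i
  have hd : ∀ s ∈ Metric.ball (0 : ℝ) ε,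
      HasDerivWithinAt (fun s : ℝ => Complex.exp (-s) * y s i) 0 (Metric.ball (0 : ℝ) ε) s := by
    intro s hs
    have h1 := (hexp s).mul (hasDerivAt_pi.1 (hball s hs) i)
    exact (h1.congr_deriv (by ring)).hasDerivWithinAt
  have h2 := Convex.norm_image_sub_le_of_norm_hasDerivWithin_le (C := 0) hd (by simp)
    (convex_ball _ _) (Metric.mem_ball_self hε) ht
  rw [zero_mul, norm_le_zero_iff, sub_eq_zero] at h2
  simp only [Complex.ofReal_zero, neg_zero, Complex.exp_zero, one_mul, hy0] at h2
  rw [← h2, ← mul_assoc, ← Complex.exp_add, add_neg_cancel, Complex.exp_zero, one_mul]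

/-- The linear equation `x' = x` with `S_h(x)_i = e^h x_i + (e^h - 1) h^(2n+2i)`, which is the flow
of `x' = x + h^(2n+2i) e_i`. -/
def affineIntegrator (n q : ℕ) : BasicIntegrator n q where
  U := Set.univ
  isOpen_U := isOpen_univ
  f := id
  analytic_f := analyticOnNhd_id
  S h x i := Complex.exp h * x i + (Complex.exp h - 1) * h ^ (2 * n + 2 * (i : ℕ))
  analytic_S x _ := by
    refine AnalyticAt.pi fun i => ?_
    have h1 : AnalyticAt ℂ (fun p : ℂ × (Fin q → ℂ) => p.1) (0, x) := analyticAt_fst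
    have h2 : AnalyticAt ℂ (fun p : ℂ × (Fin q → ℂ) => p.2 i) (0, x) :=
      ((ContinuousLinearMap.proj (R := ℂ) (φ := fun _ : Fin q => ℂ) i).comp
        (ContinuousLinearMap.snd ℂ ℂ (Fin q → ℂ))).analyticAt _
    exact (h1.cexp'.mul h2).add ((h1.cexp'.sub analyticAt_const).mul (h1.pow _))
  S_zero x _ := by simp
  symmetric x _ := Eventually.of_forall fun h => by
    funext i
    have h1 : (-h) ^ (2 * n + 2 * (i : ℕ)) = h ^ (2 * n + 2 * (i : ℕ)) :=
      Even.neg_pow ⟨n + i, by ring⟩ h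
    have h2 : Complex.exp h * Complex.exp (-h) = 1 := by
      rw [← Complex.exp_add, add_neg_cancel, Complex.exp_zero]
    simp only [h1]
    linear_combination (x i + h ^ (2 * n + 2 * (i : ℕ))) * h2
  order x _ y hy0 hy := by
    refine Asymptotics.isBigO_pi.2 fun i => ?_
    have h1 : HasExpansion (fun h => (Complex.exp h - 1) * (h : ℂ) ^ (2 * n + 2 * (i : ℕ)))
        fun m => PowerSeries.coeff m
          ((PowerSeries.exp ℂ - 1) * PowerSeries.X ^ (2 * n + 2 * (i : ℕ))) := by
      refine HasExpansion.mul_X_pow ?_ _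
      simpa using hasExpansion_exp.sub (hasExpansion_const 1)
    have h2 := (h1.isBigO_iff (2 * n + 1)).2 fun m hm => by
      rw [PowerSeries.coeff_mul_X_pow']
      split_ifs with h
      -- The factor `e^h - 1` has no constant term; this supplies the one extra degree that order
      -- `2n` demands when `i = 0`.
      · obtain rfl : m = 2 * n + 2 * (i : ℕ) := by omega
        simp
      · rfl
    refine h2.congr' ?_ EventuallyEq.rfl
    filter_upwards [solution_eq_exp hy0 hy] with t ht
    simp [ht]

variable {n q : ℕ}

theorem affineIntegrator_isReal : (affineIntegrator n q).IsReal where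
  star_mem _ _ := Set.mem_univ _
  star_f _ _ := rfl
  star_S x _ := Eventually.of_forall fun h => by
    funext i
    simp only [affineIntegrator, Pi.star_apply, star_add, star_mul', star_sub, star_pow, star_one]
    simp only [← starRingEnd_apply, ← Complex.exp_conj]

/-- The constant function `1`. -/
def affineOne : (affineIntegrator n q).functions :=
  ⟨fun _ => 1, fun _ _ => analyticAt_const, fun x hx => absurd (Set.mem_univ x) hx⟩

theorem taylor_affineOne (m : ℕ) : (affineIntegrator n q).taylor m (affineOne (n := n) (q := q)) =
    PowerSeries.coeff m (1 : PowerSeries ℂ) • affineOne (n := n) (q := q) :=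
  BasicIntegrator.functions_ext fun x hx => by
    have h := (BasicIntegrator.represents_S (B := affineIntegrator n q)).hasExpansion hx
      (affineOne (n := n) (q := q))
    have h1 := h.unique (hasExpansion_const 1) m
    rw [PowerSeries.coeff_mk] at h1
    rw [h1, Submodule.coe_smul, Pi.smul_apply, map_one]
    exact (mul_one _).symm

theorem taylor_affine_coord (m : ℕ) (i : Fin q) :
    (affineIntegrator n q).taylor m ((affineIntegrator n q).coord i) =
      PowerSeries.coeff m (PowerSeries.exp ℂ) • (affineIntegrator n q).coord i +
        PowerSeries.coeff m ((PowerSeries.exp ℂ - 1) *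
          PowerSeries.X ^ (2 * n + 2 * (i : ℕ))) • affineOne (n := n) (q := q) :=
  BasicIntegrator.functions_ext fun x hx => by
    have h := (BasicIntegrator.represents_S (B := affineIntegrator n q)).hasExpansion hx
      ((affineIntegrator n q).coord i)
    have h1 : HasExpansion (fun h => (Complex.exp h - 1) * (h : ℂ) ^ (2 * n + 2 * (i : ℕ)))
        fun m => PowerSeries.coeff m
          ((PowerSeries.exp ℂ - 1) * PowerSeries.X ^ (2 * n + 2 * (i : ℕ))) := by
      refine HasExpansion.mul_X_pow ?_ _
      simpa using hasExpansion_exp.sub (hasExpansion_const 1)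
    have h2 := (hasExpansion_exp.const_mul (x i)).add h1
    have h3 := h.unique (h2.congr (Eventually.of_forall fun t => ?_)) m
    · rw [PowerSeries.coeff_mk] at h3
      rw [h3, Submodule.coe_add, Submodule.coe_smul, Submodule.coe_smul, Pi.add_apply,
        Pi.smul_apply, Pi.smul_apply, BasicIntegrator.coord_apply i hx, smul_eq_mul, smul_eq_mul,
        mul_comm (x i)]
      simp [affineOne]
    · rw [BasicIntegrator.coord_apply i (Set.mem_univ _)]
      simp only [affineIntegrator]
      ring

theorem toOperator_apply_eq_zero {n d : ℕ} (B : BasicIntegrator n d) {v : B.functions}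
    (hv0 : v.1 0 = 1)
    (hv : ∀ m, B.taylor m v = PowerSeries.coeff m (1 : PowerSeries ℂ) • v) (m : ℕ) :
    B.toOperator (Y m) v = 0 := by
  rw [BasicIntegrator.toOperator_Y]
  exact coeff_logSeries_apply_eq_zero (V := B.functions)
    ((LinearMap.proj 0).comp B.functions.subtype) (PowerSeries.mk B.taylor)
    (by rw [PowerSeries.coeff_mk, BasicIntegrator.taylor_zero]) hv0
    (fun m => by rw [PowerSeries.coeff_mk, hv]) m

theorem toOperator_apply_eq {n d : ℕ} (B : BasicIntegrator n d) {u v : B.functions}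
    (hv0 : v.1 0 = 1) {N : ℕ}
    (hu : ∀ m, B.taylor m u = PowerSeries.coeff m (PowerSeries.exp ℂ) • u +
      PowerSeries.coeff m ((PowerSeries.exp ℂ - 1) * PowerSeries.X ^ N) • v)
    (hv : ∀ m, B.taylor m v = PowerSeries.coeff m (1 : PowerSeries ℂ) • v) (m : ℕ) :
    B.toOperator (Y m) u = (if m = 1 then u else 0) + if m = N + 1 then v else 0 := by
  rw [BasicIntegrator.toOperator_Y]
  exact coeff_logSeries_apply (V := B.functions)
    ((LinearMap.proj 0).comp B.functions.subtype) (PowerSeries.mk B.taylor)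
    (by rw [PowerSeries.coeff_mk, BasicIntegrator.taylor_zero]) hv0
    (fun m => by rw [PowerSeries.coeff_mk, hv]) (fun m => by rw [PowerSeries.coeff_mk, hu]) m

theorem affine_operator_one (m : ℕ) :
    (affineIntegrator n q).toOperator (Y m) affineOne = 0 :=
  toOperator_apply_eq_zero _ (v := affineOne) rfl taylor_affineOne m

theorem affine_operator_coord (m : ℕ) (i : Fin q) :
    (affineIntegrator n q).toOperator (Y m) ((affineIntegrator n q).coord i) =
      (if m = 1 then (affineIntegrator n q).coord i else 0) +
        if m = 2 * n + 2 * (i : ℕ) + 1 then affineOne else 0 :=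
  toOperator_apply_eq _ (v := affineOne) rfl (fun m => taylor_affine_coord m i)
    taylor_affineOne m

/-- `Y_1` fixes the coordinates and kills constants, so bracketing a constant field with it changes
the sign; two brackets restore the field. -/
theorem affine_bracket (hn : 1 ≤ n) {w : Words} {z : Fin q → ℂ}
    (h1 : (affineIntegrator n q).toOperator w affineOne = 0)
    (hz : ∀ i, (affineIntegrator n q).toOperator w ((affineIntegrator n q).coord i) =
      z i • affineOne) :
    (affineIntegrator n q).toOperator ⁅Y 1, w⁆ affineOne = 0 ∧
    ∀ i, (affineIntegrator n q).toOperator ⁅Y 1, w⁆ ((affineIntegrator n q).coord i) =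
      (-z i) • affineOne := by
  have hYc : ∀ i, (affineIntegrator n q).toOperator (Y 1)
      ((affineIntegrator n q).coord i) = (affineIntegrator n q).coord i := fun i => by
    rw [affine_operator_coord, if_pos rfl, if_neg (by omega), add_zero]
  rw [Ring.lie_def, map_sub, map_mul, map_mul]
  refine ⟨?_, fun i => ?_⟩
  · rw [LinearMap.sub_apply, Module.End.mul_apply, Module.End.mul_apply, h1,
      affine_operator_one, map_zero, map_zero, sub_zero]
  · rw [LinearMap.sub_apply, Module.End.mul_apply, Module.End.mul_apply, hYc, hz, map_smul,
      affine_operator_one, smul_zero, zero_sub]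
    exact (neg_smul (z i) (affineOne (n := n) (q := q))).symm

theorem affine_iterate (hn : 1 ≤ n) {w : Words} {z : Fin q → ℂ}
    (h1 : (affineIntegrator n q).toOperator w affineOne = 0)
    (hz : ∀ i, (affineIntegrator n q).toOperator w ((affineIntegrator n q).coord i) =
      z i • affineOne) (l : ℕ) :
    (affineIntegrator n q).toOperator ((fun X : Words => ⁅Y 1, ⁅Y 1, X⁆⁆)^[l] w) affineOne = 0 ∧
    ∀ i, (affineIntegrator n q).toOperator ((fun X : Words => ⁅Y 1, ⁅Y 1, X⁆⁆)^[l] w)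
      ((affineIntegrator n q).coord i) = z i • affineOne := by
  induction l with
  | zero => exact ⟨h1, hz⟩
  | succ l ih =>
    rw [Function.iterate_succ_apply']
    have h2 := affine_bracket hn ih.1 ih.2
    simpa only [neg_neg] using affine_bracket hn h2.1 h2.2

theorem affine_E (hn : 1 ≤ n) (m l : ℕ) (hm : m - 2 * l ≠ 1) (i : Fin q) :
    (affineIntegrator n q).toOperator (E m (l + 1)) ((affineIntegrator n q).coord i) =
      (if m - 2 * l = 2 * n + 2 * (i : ℕ) + 1 then (1 : ℂ) else 0) • affineOne := by
  refine (affine_iterate hn (affine_operator_one (m - 2 * l)) (z := fun i =>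
    if m - 2 * l = 2 * n + 2 * (i : ℕ) + 1 then (1 : ℂ) else 0) (fun i => ?_) l).2 i
  rw [affine_operator_coord, if_neg hm, zero_add]
  split_ifs
  · exact (one_smul ℂ _).symm
  · exact (zero_smul ℂ (affineOne (n := n) (q := q))).symm

/-- In this example `E (2n+2p-1) (l+1)` acts on coordinates as `Y_(2n+2p-1-2l)`, the constant field
in direction `p-1-l`. Different `l` give different unit vectors, so evaluating that component at the
origin isolates each coefficient. -/
theorem affine_independent (hn : 1 ≤ n) : (affineIntegrator n q).Independent q {0} := by
  intro p _ hpq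
  rw [Fintype.linearIndependent_iff]
  intro g hg l
  have hl := l.2
  have hlq : p - 1 - (l : ℕ) < q := by omega
  have h := congrFun (congrFun hg ⟨p - 1 - l, hlq⟩) ⟨0, rfl⟩
  rw [Finset.sum_apply, Finset.sum_apply, Finset.sum_eq_single l] at h
  · have h2 : (affineIntegrator n q).components {0} (E (2 * n + 2 * p - 1) (l + 1))
        ⟨p - 1 - l, hlq⟩ ⟨0, rfl⟩ = 1 := by
      rw [BasicIntegrator.components, affine_E hn _ _ (by omega), if_pos (by simp only; omega)]
      exact one_mul _
    rw [Pi.smul_apply, Pi.smul_apply, h2] at h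
    simpa using h
  · intro b _ hb
    have hb' := b.2
    have hbl : (b : ℕ) ≠ l := fun h => hb (Fin.ext h)
    have h2 : (affineIntegrator n q).components {0} (E (2 * n + 2 * p - 1) (b + 1))
        ⟨p - 1 - l, hlq⟩ ⟨0, rfl⟩ = 0 := by
      rw [BasicIntegrator.components, affine_E hn _ _ (by omega), if_neg (by simp only; omega)]
      exact zero_mul _
    rw [Pi.smul_apply, Pi.smul_apply, h2, smul_zero]
  · exact fun h => absurd (Finset.mem_univ _) h

end Example

/-! ### The three senses of the order conditions -/

theorem HasOrder.mono {d : ℕ} {f : (Fin d → ℂ) → (Fin d → ℂ)} {K K' : Set (Fin d → ℂ)}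
    {φ : ℝ → (Fin d → ℂ) → (Fin d → ℂ)} {r : ℕ} (h : HasOrder f K φ r) (hK : K' ⊆ K) :
    HasOrder f K' φ r := fun x hx => h x (hK hx)

/-- Necessity for single independent integrators yields the other two senses by testing on
`affineIntegrator` at the origin, a real point. -/
theorem orderImplies_of {n k : ℕ} (hn : 1 ≤ n) {α : Fin k → List ℂ} {q r : ℕ} {C : Prop}
    (h : ∀ (d : ℕ) (B : BasicIntegrator n d) (K : Set (Fin d → ℂ)), K ⊆ B.U → B.Independent q K →
      HasOrder B.f K (linComb B.S α) r → C) : OrderImplies n α q r C := by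
  have h0 : ({0} : Set (Fin q → ℂ)) ⊆ (affineIntegrator n q).U := Set.subset_univ _
  have h0' : ({0} : Set (Fin q → ℂ)) ⊆ realPoints q := by
    rintro x rfl
    exact star_zero _
  exact ⟨h, fun H => h q _ {0} h0 (affine_independent hn) ((H q _).mono h0),
    fun H => h q _ {0} h0 (affine_independent hn)
      ((H q _ affineIntegrator_isReal).mono (Set.subset_inter h0 h0'))⟩

theorem OrderImplies.orderIff {n k : ℕ} {α : Fin k → List ℂ} {q r : ℕ} {C : Prop}
    (h : OrderImplies n α q r C)
    (h' : C → ∀ (d : ℕ) (B : BasicIntegrator n d), HasOrder B.f B.U (linComb B.S α) r) :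
    OrderIff n α q r C :=
  ⟨fun d B K hK hB => ⟨h.1 d B K hK hB, fun hC => (h' hC d B).mono hK⟩,
    ⟨h.2.1, h'⟩, ⟨h.2.2, fun hC d B _ => (h' hC d B).mono Set.inter_subset_left⟩⟩

end SymConj

end

/-! ### Assembly of the order conditions -/

theorem mainTheorem2 (n k : ℕ) (hn : 1 ≤ n) (hk : 1 ≤ k) (α : Fin k → List ℂ)
    (hα : ∀ j, SymConj.IsConsistentSymConj (α j)) :
    (∃ μ : Fin k → ℕ → ℕ → ℝ, ∀ j, SymConj.IsBracketExpansion n (α j) (μ j)) ∧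
    ∀ μ : Fin k → ℕ → ℕ → ℝ, (∀ j, SymConj.IsBracketExpansion n (α j) (μ j)) →
      -- order `2n+2`
      SymConj.OrderIff n α 1 (2 * n + 2) (SymConj.c μ (2 * n + 1) 1 = 0) ∧
      -- order `2n+4`
      (SymConj.OrderImplies n α 2 (2 * n + 4)
          (SymConj.c μ (2 * n + 1) 1 = 0 ∧
            SymConj.c μ (2 * n + 3) 1 = 0 ∧ SymConj.c μ (2 * n + 3) 2 = 0) ∧
        (SymConj.InRange n μ (2 * n + 4) →
          SymConj.OrderIff n α 2 (2 * n + 4)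
            (SymConj.c μ (2 * n + 1) 1 = 0 ∧
              SymConj.c μ (2 * n + 3) 1 = 0 ∧ SymConj.c μ (2 * n + 3) 2 = 0))) ∧
      -- order `2n+6`
      (2 ≤ n →
        SymConj.OrderImplies n α 3 (2 * n + 6)
          (SymConj.c μ (2 * n + 1) 1 = 0 ∧
            SymConj.c μ (2 * n + 3) 1 = 0 ∧ SymConj.c μ (2 * n + 3) 2 = 0 ∧
            SymConj.c μ (2 * n + 5) 1 = 0 ∧ SymConj.c μ (2 * n + 5) 2 = 0 ∧
            SymConj.c μ (2 * n + 5) 3 = 0) ∧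
        (SymConj.InRange n μ (2 * n + 6) →
          SymConj.OrderIff n α 3 (2 * n + 6)
            (SymConj.c μ (2 * n + 1) 1 = 0 ∧
              SymConj.c μ (2 * n + 3) 1 = 0 ∧ SymConj.c μ (2 * n + 3) 2 = 0 ∧
              SymConj.c μ (2 * n + 5) 1 = 0 ∧ SymConj.c μ (2 * n + 5) 2 = 0 ∧
              SymConj.c μ (2 * n + 5) 3 = 0))) := by

  refine ⟨?_, fun μ hμ => ?_⟩
  · choose μ hμ using fun j => SymConj.exists_isBracketExpansion hn (hα j)
    exact ⟨μ, hμ⟩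
  have h2 : SymConj.OrderImplies n α 1 (2 * n + 2) (SymConj.c μ (2 * n + 1) 1 = 0) :=
    SymConj.orderImplies_of hn fun d B K hK hB h =>
      SymConj.condition_one_of_hasOrder hn hk hα hμ hK hB le_rfl (by omega) h
  have h4 : SymConj.OrderImplies n α 2 (2 * n + 4) (SymConj.c μ (2 * n + 1) 1 = 0 ∧
      SymConj.c μ (2 * n + 3) 1 = 0 ∧ SymConj.c μ (2 * n + 3) 2 = 0) :=
    SymConj.orderImplies_of hn fun d B K hK hB h =>
      ⟨SymConj.condition_one_of_hasOrder hn hk hα hμ hK hB (by omega) (by omega) h,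
        SymConj.condition_three_of_hasOrder hn hk hα hμ hK hB le_rfl (by omega) h⟩
  refine ⟨h2.orderIff fun h1 d B => ?_,
    ⟨h4, fun hr => h4.orderIff fun ⟨h1, h3, h3'⟩ d B => ?_⟩, fun hn2 => ?_⟩
  -- Order `2n+2` is always in range, since `2n+2 ≤ 4n+1` for `n ≥ 1`.
  · exact SymConj.hasOrder_of_defect_mem hn hk le_rfl (SymConj.defect_mem_of_inRange hn hα hμ h1
      (Or.inl (by omega)) (SymConj.sum_logDefect_mem_three hn hα hμ h1))
  · exact SymConj.hasOrder_of_defect_mem hn hk le_rfl (SymConj.defect_mem_of_inRange hn hα hμ h1 hr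
      (SymConj.sum_logDefect_mem_five hn hα hμ h1 h3 h3'))
  have h6 : SymConj.OrderImplies n α 3 (2 * n + 6) (SymConj.c μ (2 * n + 1) 1 = 0 ∧
      SymConj.c μ (2 * n + 3) 1 = 0 ∧ SymConj.c μ (2 * n + 3) 2 = 0 ∧
      SymConj.c μ (2 * n + 5) 1 = 0 ∧ SymConj.c μ (2 * n + 5) 2 = 0 ∧
      SymConj.c μ (2 * n + 5) 3 = 0) :=
    SymConj.orderImplies_of hn fun d B K hK hB h => by
      have h3 := SymConj.condition_three_of_hasOrder hn hk hα hμ hK hB (by omega) (by omega) h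
      exact ⟨SymConj.condition_one_of_hasOrder hn hk hα hμ hK hB (by omega) (by omega) h,
        h3.1, h3.2, SymConj.condition_five_of_hasOrder hn hk hα hμ hK hn2 hB le_rfl (by omega) h⟩
  refine ⟨h6, fun hr => h6.orderIff fun ⟨h1, h3, h3', h5, h5', h5''⟩ d B => ?_⟩
  exact SymConj.hasOrder_of_defect_mem hn hk le_rfl (SymConj.defect_mem_of_inRange hn hα hμ h1 hr
    (SymConj.sum_logDefect_mem_seven hn2 hα hμ h1 h3 h3' h5 h5' h5''))
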